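/- **Model.** Let $Y,Y^*\in\{0,1\}$ be a response and its error-prone surrogate and let $Z$ be a random vector in $\mathbb R^p$. Let $g$ be a link function on $(0,1)$, strictly monotone and differentiable, and let $g_0(z;\nu),g_1(z;\nu)$, $\nu\in\mathbb R^q$, be given real functions, measurable in $z$. For $\theta=(\beta_0^*,\beta^{T},\nu^{T})^{T}\in\mathbb R^{d}$, $d=1+p+q$, let $g(\mu(z))=\beta^*_0+z^{T}\beta$ with $\mu(z)\in(0,1)$, $\operatorname{logit}\gamma_{01}(z)=g_0(z;\nu)$, $\operatorname{logit}\gamma_{10}(z)=g_1(z;\nu)$ and $\mu^*(z)=\gamma_{01}(z)+\{1-\gamma_{01}(z)-\gamma_{10}(z)\}\mu(z)$. Put $a_0(1,z)=\gamma_{01}(z)=1-a_0(0,z)$, $a_1(0,z)=\gamma_{10}(z)=1-a_1(1,z)$, and $$f(y,y^*|z)=\{\mu(z)a_1(y^*,z)\}^{y}\{(1-\mu(z))a_0(y^*,z)\}^{1-y},\qquad f(y^*|z)=\mu^*(z)^{y^*}\{1-\mu^*(z)\}^{1-y^*}.$$ Suppose that for a true value $\theta_0=(\beta^*_{00},\beta_{10},\dots,\beta_{p0},\nu_0^{T})^{T}$,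 $P(Y=1|Z)=\mu(Z)$, $P(Y^*=1|Y=0,Z)=\gamma_{01}(Z)$ and $P(Y^*=0|Y=1,Z)=\gamma_{10}(Z)$ almost surely. Let $(Y_i,Y_i^*,Z_i)$ be i.i.d. copies of $(Y,Y^*,Z)$. For each $n$ the main study sample $\mathcal M$ consists of the first $n$ subjects, for which $(Y_i^*,Z_i)$ is observed; the validation sample $\mathcal V\subseteq\mathcal M$ is a random subset of non-random size $n_v$, selected independently of the data of the $n$ subjects, for which $Y_i$ is observed as well; and $n_v/n\to\delta\in(0,1]$. **Regularity conditions.** There is an open set $N\ni\theta_0$ such that, for almost every $z$, $\beta_0^*+z^{T}\beta$ lies in $g((0,1))$ for all $\theta\in N$; and, both for $L=\log f(y,y^*|z)$ and for $L=\log f(y^*|z)$: (i) for almost every $z$ and all $y,y^*$, $L$ is three times continuously differentiable in $\theta$ on $N$; (ii) at $\theta_0$ the first partial derivatives of $L$ are square integrable and the second partial derivatives are integrable under the law of $(Y,Y^*,Z)$; (iii) almost surely all third partial derivatives of $L$ are bounded in absolute value, uniformly over $\theta\in N$, by a function of $(Y,Y^*,Z)$ with finite expectation. Moreover $\delta I_1^*(\theta_0)+(1-\delta)I_2^*(\theta_0)$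 is positive definite, where $I_1^*(\theta_0)$ and $I_2^*(\theta_0)$ are the second moment matrices of the scores $\partial_\theta\log f(Y,Y^*|Z)$ and $\partial_\theta\log f(Y^*|Z)$ at $\theta_0$. **Penalty.** For $\lambda\ge0$ let $\rho_\lambda:[0,\infty)\to[0,\infty)$ be continuous with $\rho_\lambda(0)=0$. Let $\lambda_n\ge0$, and suppose that there are constants $C>0$ and $D$ such that for every $n$, $\rho_{\lambda_n}$ is twice differentiable on $(C\lambda_n,\infty)$ with $|\rho''_{\lambda_n}(\xi_1)-\rho''_{\lambda_n}(\xi_2)|\le D|\xi_1-\xi_2|$ for all $\xi_1,\xi_2>C\lambda_n$. Put $$a_n=\max\{|\rho'_{\lambda_n}(|\beta_{j0}|)|:\beta_{j0}\neq0\},\qquad b_n=\max\{|\rho''_{\lambda_n}(|\beta_{j0}|)|:\beta_{j0}\ne0\}$$ (both $0$ if all $\beta_{j0}$ vanish), and let $$Q^*_{\mathrm{ML}}(\theta)=\sum_{i\in\mathcal V}\log f(Y_i,Y_i^*|Z_i)+\sum_{i\in\mathcal M\setminus\mathcal V}\log f(Y_i^*|Z_i)-n\sum_{j=1}^p\rho_{\lambda_n}(|\beta_j|).$$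 **Theorem.** If $\lambda_n\to0$, $a_n\to 0$ and $b_n\to0$ as $n\to\infty$, then there are random vectors $\widehat\theta_{\mathrm{ML}}=\widehat\theta_{\mathrm{ML},n}$ such that, with probability tending to one, $\widehat\theta_{\mathrm{ML}}$ is a local maximizer of $Q^*_{\mathrm{ML}}$, and $$\|\widehat\theta_{\mathrm{ML}}-\theta_0\|_2=O_p(n^{-1/2}+a_n).$$ -/

import Mathlib

open MeasureTheory ProbabilityTheory Filter Topology

/-- The parameter space `ℝ^d`, `d = 1 + p + q`, with the Euclidean norm.  A parameter `θ` consists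
of an intercept, the `p` regression coefficients and the `q` parameters `ν` of the
misclassification model. -/
abbrev Param (p q : ℕ) : Type := EuclideanSpace ℝ (Unit ⊕ Fin p ⊕ Fin q)

/-- The intercept of the response model. -/
def Param.intercept {p q : ℕ} (θ : Param p q) : ℝ := θ (Sum.inl ())

/-- The regression coefficients of the response model. -/
def Param.beta {p q : ℕ} (θ : Param p q) (j : Fin p) : ℝ := θ (Sum.inr (Sum.inl j))

/-- The parameters of the misclassification model. -/
def Param.nu {p q : ℕ} (θ : Param p q) (k : Fin q) : ℝ := θ (Sum.inr (Sum.inr k))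

/-- A full observation `(Y, Y*, Z)`: true response, surrogate response, covariates.
The value `1` of a binary response is `true`, the value `0` is `false`. -/
abbrev Obs (p : ℕ) : Type := Bool × Bool × (Fin p → ℝ)

/-- The parametric model: a generalized linear model for the binary response with a link function
`g` on `(0,1)`, and misclassification probabilities whose logits are the given functions
`g₀(z; ν)` and `g₁(z; ν)`. -/
structure MisclassModel (p q : ℕ) where
  /-- the link function (only its values on `(0,1)` are used) -/
  link : ℝ → ℝ
  link_monotone : StrictMonoOn link (Set.Ioo 0 1) ∨ StrictAntiOn link (Set.Ioo 0 1)
  link_differentiable : DifferentiableOn ℝ link (Set.Ioo 0 1)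
  /-- `logit γ₀₁(z) = g₀ z ν` -/
  g₀ : (Fin p → ℝ) → (Fin q → ℝ) → ℝ
  /-- `logit γ₁₀(z) = g₁ z ν` -/
  g₁ : (Fin p → ℝ) → (Fin q → ℝ) → ℝ
  measurable_g₀ : ∀ ν, Measurable fun z => g₀ z ν
  measurable_g₁ : ∀ ν, Measurable fun z => g₁ z ν

namespace MisclassModel

variable {p q : ℕ} (M : MisclassModel p q)

/-- The linear predictor `β₀* + zᵀ β`. -/
def linPred (θ : Param p q) (z : Fin p → ℝ) : ℝ := θ.intercept + ∑ j, z j * θ.beta j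

/-- `μ(z)`, the solution in `(0,1)` of `g(μ(z)) = β₀* + zᵀ β` whenever there is one. -/
noncomputable def mu (θ : Param p q) (z : Fin p → ℝ) : ℝ :=
  Function.invFunOn M.link (Set.Ioo 0 1) (linPred θ z)

/-- `γ₀₁(z) = P(Y* = 1 | Y = 0, Z = z)`, the number in `(0,1)` with logit `g₀(z; ν)`. -/
noncomputable def gamma01 (θ : Param p q) (z : Fin p → ℝ) : ℝ := Real.sigmoid (M.g₀ z θ.nu)

/-- `γ₁₀(z) = P(Y* = 0 | Y = 1, Z = z)`, the number in `(0,1)` with logit `g₁(z; ν)`. -/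
noncomputable def gamma10 (θ : Param p q) (z : Fin p → ℝ) : ℝ := Real.sigmoid (M.g₁ z θ.nu)

/-- `μ*(z) = γ₀₁(z) + {1 - γ₀₁(z) - γ₁₀(z)} μ(z)`. -/
noncomputable def muStar (θ : Param p q) (z : Fin p → ℝ) : ℝ :=
  M.gamma01 θ z + (1 - M.gamma01 θ z - M.gamma10 θ z) * M.mu θ z

/-- `a₀(y*, z) = P(Y* = y* | Y = 0, Z = z)`. -/
noncomputable def a0 (θ : Param p q) (ys : Bool) (z : Fin p → ℝ) : ℝ :=
  if ys then M.gamma01 θ z else 1 - M.gamma01 θ z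

/-- `a₁(y*, z) = P(Y* = y* | Y = 1, Z = z)`. -/
noncomputable def a1 (θ : Param p q) (ys : Bool) (z : Fin p → ℝ) : ℝ :=
  if ys then 1 - M.gamma10 θ z else M.gamma10 θ z

/-- The conditional density `f(y, y* | z)`, contributed by a validation subject. -/
noncomputable def densV (θ : Param p q) (y ys : Bool) (z : Fin p → ℝ) : ℝ :=
  if y then M.mu θ z * M.a1 θ ys z else (1 - M.mu θ z) * M.a0 θ ys z

/-- The conditional density `f(y* | z)`, contributed by a subject outside the validation sample. -/
noncomputable def densM (θ : Param p q) (ys : Bool) (z : Fin p → ℝ) : ℝ :=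
  if ys then M.muStar θ z else 1 - M.muStar θ z

/-- `log f(y, y* | z)` as a function of the parameter. -/
noncomputable def logV (o : Obs p) (θ : Param p q) : ℝ :=
  Real.log (M.densV θ o.1 o.2.1 o.2.2)

/-- `log f(y* | z)` as a function of the parameter. -/
noncomputable def logM (o : Obs p) (θ : Param p q) : ℝ :=
  Real.log (M.densM θ o.2.1 o.2.2)

/-- The law `D` of `(Y, Y*, Z)` follows the model with parameter `θ`:
`P(Y = 1 | Z) = μ(Z)`, and `P(Y* = 1 | Y, Z)` is `1 - γ₁₀(Z)` if `Y = 1` and `γ₀₁(Z)` if `Y = 0`.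
The law of `Z` is arbitrary. -/
structure Follows (θ : Param p q) (D : Measure (Obs p)) : Prop where
  response :
    D⟦{o : Obs p | o.1 = true} |
        MeasurableSpace.comap (fun o : Obs p => o.2.2) inferInstance⟧
      =ᵐ[D] fun o => M.mu θ o.2.2
  surrogate :
    D⟦{o : Obs p | o.2.1 = true} |
        MeasurableSpace.comap (fun o : Obs p => (o.1, o.2.2)) inferInstance⟧
      =ᵐ[D] fun o => if o.1 then 1 - M.gamma10 θ o.2.2 else M.gamma01 θ o.2.2

end MisclassModel

/-- The partial derivative `∂F/∂θ_j` at `θ`. -/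
noncomputable def pderiv {p q : ℕ} (j : Unit ⊕ Fin p ⊕ Fin q) (F : Param p q → ℝ)
    (θ : Param p q) : ℝ :=
  fderiv ℝ F θ (EuclideanSpace.single j 1)

/-- The information matrix `E[(∂ log f)(∂ log f)ᵀ]` at `θ`, where `L o` is the log-density of the
observation `o` as a function of the parameter. -/
noncomputable def fisherInfo {p q : ℕ} (D : Measure (Obs p)) (L : Obs p → Param p q → ℝ)
    (θ : Param p q) : Matrix (Unit ⊕ Fin p ⊕ Fin q) (Unit ⊕ Fin p ⊕ Fin q) ℝ :=
  Matrix.of fun j k => ∫ o, pderiv j (L o) θ * pderiv k (L o) θ ∂D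

/-- Classical smoothness and moment conditions on a log-density `L`, at the true value `θ₀` and on
an open set `N` containing it. -/
structure SmoothLogDensity {p q : ℕ} (D : Measure (Obs p)) (L : Obs p → Param p q → ℝ)
    (θ₀ : Param p q) (N : Set (Param p q)) : Prop where
  /-- three continuous derivatives in the parameter, for almost every `z` and all `y`, `y*` -/
  contDiffOn : ∀ᵐ o ∂D, ∀ y ys : Bool, ContDiffOn ℝ 3 (L (y, ys, o.2.2)) N
  /-- square integrable score at the true value -/
  score : ∀ j, MemLp (fun o => pderiv j (L o) θ₀) 2 D
  /-- integrable second derivatives at the true value -/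
  hessian : ∀ j k, Integrable (fun o => pderiv k (pderiv j (L o)) θ₀) D
  /-- third derivatives dominated on `N` by an integrable function of the observation -/
  third : ∃ B : Obs p → ℝ, Integrable B D ∧
    ∀ᵐ o ∂D, ∀ θ ∈ N, ∀ j k l, |pderiv l (pderiv k (pderiv j (L o))) θ| ≤ B o

/-- The regularity conditions on the distributions of the main study and the validation data, with
`δ` the limiting validation ratio and `N` an open set containing the true value `θ₀`. -/
structure RegularityConditions {p q : ℕ} (M : MisclassModel p q) (D : Measure (Obs p)) (δ : ℝ)
    (θ₀ : Param p q) (N : Set (Param p q)) : Prop where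
  isOpen : IsOpen N
  mem : θ₀ ∈ N
  /-- for parameters in `N` the equation defining `μ(z)` is solvable in `(0,1)` -/
  range : ∀ᵐ o ∂D, ∀ θ ∈ N, MisclassModel.linPred θ o.2.2 ∈ M.link '' Set.Ioo 0 1
  smoothV : SmoothLogDensity D M.logV θ₀ N
  smoothM : SmoothLogDensity D M.logM θ₀ N
  /-- positive definiteness of `δ I₁*(θ₀) + (1 - δ) I₂*(θ₀)` -/
  posDef : (δ • fisherInfo D M.logV θ₀ + (1 - δ) • fisherInfo D M.logM θ₀).PosDef

/-- `ρ` is a family of penalty functions `ρ_λ` on `[0, ∞)`, `λ ≥ 0`: continuous, nonnegative and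
zero at `0`. -/
structure IsPenalty (ρ : ℝ → ℝ → ℝ) : Prop where
  continuousOn : ∀ lam, 0 ≤ lam → ContinuousOn (ρ lam) (Set.Ici 0)
  nonneg : ∀ lam, 0 ≤ lam → ∀ ξ, 0 ≤ ξ → 0 ≤ ρ lam ξ
  zero : ∀ lam, 0 ≤ lam → ρ lam 0 = 0

/-- The smoothness condition on the penalty away from the origin: for constants `C` and `D`,
`ρ_{λ_n}` is twice differentiable on `(C λ_n, ∞)` and
`|ρ''_{λ_n}(ξ₁) - ρ''_{λ_n}(ξ₂)| ≤ D |ξ₁ - ξ₂|` for all `ξ₁, ξ₂ > C λ_n`. -/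
def PenaltySmooth (ρ : ℝ → ℝ → ℝ) (lam : ℕ → ℝ) : Prop :=
  ∃ C D : ℝ, 0 < C ∧ ∀ n,
    DifferentiableOn ℝ (ρ (lam n)) (Set.Ioi (C * lam n)) ∧
    DifferentiableOn ℝ (deriv (ρ (lam n))) (Set.Ioi (C * lam n)) ∧
    ∀ ξ₁ > C * lam n, ∀ ξ₂ > C * lam n,
      |deriv (deriv (ρ (lam n))) ξ₁ - deriv (deriv (ρ (lam n))) ξ₂| ≤ D * |ξ₁ - ξ₂|

/-- `a_n = max {|ρ'_{λ_n}(|β_{j0}|)| : β_{j0} ≠ 0}`, which is `0` if all `β_{j0}` vanish. -/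
noncomputable def aSeq {p q : ℕ} (ρ : ℝ → ℝ → ℝ) (lam : ℕ → ℝ) (θ₀ : Param p q) (n : ℕ) : ℝ :=
  ⨆ j : {j : Fin p // θ₀.beta j ≠ 0}, |deriv (ρ (lam n)) (|θ₀.beta j.1|)|

/-- `b_n = max {|ρ''_{λ_n}(|β_{j0}|)| : β_{j0} ≠ 0}`, which is `0` if all `β_{j0}` vanish. -/
noncomputable def bSeq {p q : ℕ} (ρ : ℝ → ℝ → ℝ) (lam : ℕ → ℝ) (θ₀ : Param p q) (n : ℕ) : ℝ :=
  ⨆ j : {j : Fin p // θ₀.beta j ≠ 0}, |deriv (deriv (ρ (lam n))) (|θ₀.beta j.1|)|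

/-- The observed-data log-likelihood `ℓ*(θ)` of the main study sample `{0, …, n-1}` with validation
subsample `V`, for the observations `x i`. -/
noncomputable def logLik {p q : ℕ} (M : MisclassModel p q) (n : ℕ) (V : Finset ℕ) (x : ℕ → Obs p)
    (θ : Param p q) : ℝ :=
  ∑ i ∈ V, M.logV (x i) θ + ∑ i ∈ Finset.range n \ V, M.logM (x i) θ

/-- The penalized observed-data log-likelihood
`Q*_ML(θ) = ℓ*(θ) - n ∑_j ρ_λ(|β_j|)`. -/
noncomputable def penLogLik {p q : ℕ} (M : MisclassModel p q) (ρ : ℝ → ℝ → ℝ) (lam : ℝ) (n : ℕ)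
    (V : Finset ℕ) (x : ℕ → Obs p) (θ : Param p q) : ℝ :=
  logLik M n V x θ - n * ∑ j : Fin p, ρ lam |θ.beta j|

/-- The sampling scheme: the full observations `X i` are i.i.d. with law `D`; for every `n` the main
study sample is `{0, …, n-1}`, and the validation sample `V n` is a random subset of it of size
`nv n`, selected independently of the data. -/
structure ValidationDesign {p : ℕ} {Ω : Type*} [MeasurableSpace Ω] (P : Measure Ω)
    (D : Measure (Obs p)) (X : ℕ → Ω → Obs p) (nv : ℕ → ℕ) (V : ℕ → Ω → Finset ℕ) : Prop where
  measurable_obs : ∀ i, Measurable (X i)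
  law : ∀ i, HasLaw (X i) D P
  indep : iIndepFun X P
  measurable_sel : ∀ n, Measurable (V n)
  subset : ∀ n ω, V n ω ⊆ Finset.range n
  card : ∀ n ω, (V n ω).card = nv n
  indep_sel : ∀ n, IndepFun (V n) (fun ω (i : Fin n) => X i ω) P

/-- `U_n = O_p(r_n)`: for every `ε > 0` there is a `K` such that `P(|U_n| > K r_n) ≤ ε` for all
large `n`. -/
def IsBigOInProb {Ω : Type*} [MeasurableSpace Ω] (P : Measure Ω) (U : ℕ → Ω → ℝ) (r : ℕ → ℝ) :
    Prop :=
  ∀ ε : ℝ, 0 < ε → ∃ K : ℝ, ∀ᶠ n in atTop, P {ω | K * r n < |U n ω|} ≤ ENNReal.ofReal ε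

/-! Write α_n = n^{-1/2} + a_n. The heart of the matter is the classical sphere argument: for every
ε there is K such that, with probability at least 1 - ε for large n, the penalized likelihood is
smaller everywhere on the sphere of radius K α_n about θ₀ than at θ₀ itself. A maximizer over the
closed ball is then interior, hence a local maximizer within K α_n of θ₀.

On that sphere every contribution is measured against n α_n². The score is O_p(√n), and √n ≤ n α_n,
so the linear Taylor term is at most a multiple of K n α_n². The Hessian is -n times the limiting
information up to a small multiple of n, so positive definiteness makes the quadratic term at most a
negative multiple of K² n α_n². The cubic remainder is O_p(n α_n³) by domination of the third
derivatives, hence of smaller order. The penalty can help a competitor only through the nonzero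
coefficients, by at most p K n α_n² (from a_n) plus smaller terms (from b_n and the Lipschitz second
derivative), since at a zero coefficient it is already minimal. Taking K large lets the quadratic
term win; this is `eventually_penLogLik_lt`.

The probabilistic input is `negligible_not_goodSample`. The score has mean zero and the Hessian has
mean minus the information (the Bartlett identities). Because the responses take finitely many
values, these follow by differentiating a finite sum of densities equal to 1 for fixed z and then
averaging over Z, without differentiating under an integral. Moment bounds are proved for sums over
a fixed set of subjects, uniformly in the set, and passed to the random validation sample and its
complement by conditioning on the selection.

The estimator must be measurable and must not depend on ε. `exists_measurable_isLocalMax` takes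
measurable maximizers over the balls of radius K α_n, K a natural number, and uses the smallest K
whose maximizer is interior; this K is bounded by any K that works for a given ε. -/

/-! ### Measurable maximizers of random continuous functions. -/

/-- For a random continuous function on a compact space, the event that the maximum is attained on
a given closed set is measurable. -/
theorem measurableSet_exists_argmax {Ω C : Type*} [MeasurableSpace Ω] [MetricSpace C]
    [CompactSpace C] {G : Ω → C → ℝ} (hm : ∀ c, Measurable fun ω => G ω c)
    (hc : ∀ ω, Continuous (G ω)) {T : Set C} (hT : IsClosed T) :
    MeasurableSet {ω | ∃ c ∈ T, ∀ c', G ω c' ≤ G ω c} := by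
  rcases T.eq_empty_or_nonempty with rfl | hne
  · simp
  obtain ⟨Q, hQc, hQd⟩ := TopologicalSpace.exists_countable_dense C
  obtain ⟨R, hRT, hRc, hRd⟩ :=
    (TopologicalSpace.IsSeparable.of_separableSpace T).exists_countable_dense_subset
  -- Countable dense subsets of the whole space and of `T`, together with the tolerances 1/(k+1),
  -- turn the event into countable operations. Conversely, near-maximality on `T` yields exact
  -- maximality because the maximum over the compact set `T` is attained.
  have key : {ω | ∃ c ∈ T, ∀ c', G ω c' ≤ G ω c} =
      ⋂ c' ∈ Q, ⋂ k : ℕ, ⋃ c ∈ R, {ω | G ω c' - 1 / ((k : ℝ) + 1) < G ω c} := by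
    ext ω
    simp only [Set.mem_ofPred_eq, Set.mem_iInter, Set.mem_iUnion, exists_prop]
    constructor
    · rintro ⟨c, hcT, hmax⟩ c' _ k
      have hU : IsOpen {x | G ω c' - 1 / ((k : ℝ) + 1) < G ω x} :=
        isOpen_lt continuous_const (hc ω)
      have hcU : c ∈ {x | G ω c' - 1 / ((k : ℝ) + 1) < G ω x} := by
        have : (0 : ℝ) < 1 / ((k : ℝ) + 1) := by positivity
        have := hmax c'
        simp only [Set.mem_ofPred_eq]
        linarith
      obtain ⟨x, hxU, hxR⟩ := mem_closure_iff.1 (hRd hcT) _ hU hcU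
      exact ⟨x, hxR, hxU⟩
    · intro h
      obtain ⟨c, hcT, hmax⟩ := hT.isCompact.exists_isMaxOn hne (hc ω).continuousOn
      refine ⟨c, hcT, ?_⟩
      have hcl : IsClosed {x | G ω x ≤ G ω c} := isClosed_le (hc ω) continuous_const
      have hsub : Q ⊆ {x | G ω x ≤ G ω c} := by
        intro c' hc'
        refine le_of_forall_pos_le_add fun (ε : ℝ) hε => ?_
        obtain ⟨k, hk⟩ := exists_nat_one_div_lt hε
        obtain ⟨x, hxR, hx⟩ := h c' hc' k
        have := hmax (hRT hxR)
        simp only [Set.mem_ofPred_eq] at this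
        linarith
      intro c'
      exact closure_minimal hsub hcl (hQd c')
  rw [key]
  refine MeasurableSet.biInter hQc fun c' _ => MeasurableSet.iInter fun k =>
    MeasurableSet.biUnion hRc fun c _ => ?_
  exact measurableSet_lt ((hm c').sub_const _) (hm c)

/-- A random continuous function on a nonempty compact set has a measurable maximizer. -/
theorem exists_measurable_argmax {Ω E : Type*} [MeasurableSpace Ω] [MetricSpace E]
    [MeasurableSpace E] [BorelSpace E] {S : Set E} (hS : IsCompact S) (hne : S.Nonempty)
    {F : Ω → E → ℝ} (hm : ∀ θ ∈ S, Measurable fun ω => F ω θ)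
    (hc : ∀ ω, ContinuousOn (F ω) S) :
    ∃ t : Ω → E, Measurable t ∧ ∀ ω, t ω ∈ S ∧ IsMaxOn (F ω) S (t ω) := by
  have : CompactSpace S := isCompact_iff_compactSpace.1 hS
  have : Nonempty S := hne.to_subtype
  -- A compact metric space is a continuous image of the Cantor set, whose order inherited from ℝ
  -- allows a canonical choice: the least maximizer of the pulled-back function.
  obtain ⟨f, hf, hfs⟩ := exists_nat_bool_continuous_surjective_of_compact S
  set φ : cantorSet → S := f ∘ cantorSetHomeomorphNatToBool with hφ
  have hφc : Continuous φ := hf.comp cantorSetHomeomorphNatToBool.continuous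
  have hφs : Function.Surjective φ := hfs.comp cantorSetHomeomorphNatToBool.surjective
  have : CompactSpace cantorSet := isCompact_iff_compactSpace.1 isCompact_cantorSet
  have : Nonempty cantorSet := ⟨(hφs (Classical.arbitrary S)).choose⟩
  set G : Ω → cantorSet → ℝ := fun ω c => F ω (φ c) with hG
  have hGm : ∀ c, Measurable fun ω => G ω c := fun c => hm _ (φ c).2
  have hGc : ∀ ω, Continuous (G ω) := fun ω =>
    (continuousOn_iff_continuous_domRestrict.1 (hc ω)).comp hφc
  have hleast : ∀ ω, ∃ c, IsLeast {c | ∀ c', G ω c' ≤ G ω c} c := by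
    intro ω
    have hcl : IsClosed {c | ∀ c', G ω c' ≤ G ω c} := by
      simp only [Set.ofPred_forall]
      exact isClosed_iInter fun c' => isClosed_le continuous_const (hGc ω)
    refine hcl.isCompact.exists_isLeast ?_
    obtain ⟨c, -, h⟩ := isCompact_univ.exists_isMaxOn Set.univ_nonempty (hGc ω).continuousOn
    exact ⟨c, fun c' => h (Set.mem_univ c')⟩
  choose τ hτ using hleast
  have hτm : Measurable τ := by
    refine Measurable.of_comap_le ?_
    have hcoe : Measurable fun ω => (τ ω : ℝ) := by
      refine measurable_of_Iic fun s => ?_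
      -- The least maximizer lies below s exactly when some maximizer does, which is the event of
      -- the preceding lemma for a closed set.
      have : (fun ω => (τ ω : ℝ)) ⁻¹' Set.Iic s =
          {ω | ∃ c ∈ (Subtype.val ⁻¹' Set.Iic s : Set cantorSet), ∀ c', G ω c' ≤ G ω c} := by
        ext ω
        constructor
        · intro h
          exact ⟨τ ω, h, (hτ ω).1⟩
        · rintro ⟨c, hcs, hmax⟩
          exact le_trans (Subtype.coe_le_coe.2 ((hτ ω).2 hmax)) (Set.mem_Iic.1 hcs)
      rw [this]
      exact measurableSet_exists_argmax hGm hGc (isClosed_Iic.preimage continuous_subtype_val)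
    exact (hcoe.subtype_mk (h := fun ω => (τ ω).2)).comap_le
  refine ⟨fun ω => φ (τ ω), (measurable_subtype_coe.comp hφc.measurable).comp hτm, fun ω =>
    ⟨(φ (τ ω)).2, fun θ hθ => ?_⟩⟩
  obtain ⟨c, hcθ⟩ := hφs ⟨θ, hθ⟩
  have := (hτ ω).1 c
  simpa [hG, hcθ] using this

/-! ### Partial derivatives, Taylor expansion, and differentiation of ∑ f = 1. -/

section Calculus

variable {p q : ℕ}

theorem fderiv_apply_eq_sum_pderiv (F : Param p q → ℝ) (x h : Param p q) :
    fderiv ℝ F x h = ∑ j, h j * pderiv j F x := by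
  have hh : h = ∑ j, h j • EuclideanSpace.single j (1 : ℝ) := by
    ext i
    simp [Pi.single_apply, -Fintype.sum_sum_type]
  conv_lhs => rw [hh]
  simp [map_sum, pderiv, -Fintype.sum_sum_type]

theorem hasDerivAt_comp_line {F : Param p q → ℝ} {x h : Param p q} {t : ℝ}
    (hF : DifferentiableAt ℝ F (x + t • h)) :
    HasDerivAt (fun s : ℝ => F (x + s • h)) (∑ j, h j * pderiv j F (x + t • h)) t := by
  rw [← fderiv_apply_eq_sum_pderiv]
  have hl : HasDerivAt (fun s : ℝ => x + s • h) h t := by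
    simpa using ((hasDerivAt_id t).smul_const h).const_add x
  exact hF.hasFDerivAt.comp_hasDerivAt t hl

theorem contDiffOn_pderiv {F : Param p q → ℝ} {N : Set (Param p q)} (hN : IsOpen N) {m n : ℕ}
    (hF : ContDiffOn ℝ n F N) (hmn : m + 1 ≤ n) (j : Unit ⊕ Fin p ⊕ Fin q) :
    ContDiffOn ℝ m (pderiv j F) N := by
  have h := hF.fderiv_of_isOpen hN (m := m) (by exact_mod_cast hmn)
  exact h.clm_apply contDiffOn_const

/-- A second order Taylor bound on the unit interval. -/
theorem abs_taylor_le_of_abs_deriv_le {φ φ₁ φ₂ φ₃ : ℝ → ℝ} {K : ℝ}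
    (h₀ : ∀ t ∈ Set.Icc (0 : ℝ) 1, HasDerivAt φ (φ₁ t) t)
    (h₁ : ∀ t ∈ Set.Icc (0 : ℝ) 1, HasDerivAt φ₁ (φ₂ t) t)
    (h₂ : ∀ t ∈ Set.Icc (0 : ℝ) 1, HasDerivAt φ₂ (φ₃ t) t)
    (h₃ : ∀ t ∈ Set.Icc (0 : ℝ) 1, |φ₃ t| ≤ K) :
    |φ 1 - φ 0 - φ₁ 0 - φ₂ 0 / 2| ≤ K := by
  have hK : 0 ≤ K := (abs_nonneg _).trans (h₃ 0 (by simp))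
  -- The mean value inequality is applied three times, each time after subtracting the Taylor part
  -- already found. On [0,1] each application preserves the bound K; the sharper K/6 is not needed.
  have mvt : ∀ {f f' : ℝ → ℝ}, (∀ t ∈ Set.Icc (0 : ℝ) 1, HasDerivAt f (f' t) t) →
      (∀ t ∈ Set.Icc (0 : ℝ) 1, |f' t| ≤ K) → ∀ t ∈ Set.Icc (0 : ℝ) 1, |f t - f 0| ≤ K := by
    intro f f' hf hb t ht
    have := norm_image_sub_le_of_norm_deriv_le_segment' (a := 0) (b := 1) (C := K)
      (fun x hx => (hf x hx).hasDerivWithinAt)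
      (fun x hx => by simpa using hb x (Set.Ico_subset_Icc_self hx)) t ht
    rw [Real.norm_eq_abs] at this
    refine this.trans ?_
    have := ht.2
    nlinarith
  have e₂ := mvt h₂ h₃
  have e₁ := mvt (f := fun t => φ₁ t - φ₂ 0 * t) (f' := fun t => φ₂ t - φ₂ 0)
    (fun t ht => ((h₁ t ht).sub ((hasDerivAt_id t).const_mul (φ₂ 0))).congr_deriv (by simp)) e₂
  have e₀ := mvt (f := fun t => φ t - φ₁ 0 * t - φ₂ 0 * t ^ 2 / 2)
    (f' := fun t => φ₁ t - φ₂ 0 * t - φ₁ 0)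
    (fun t ht => by
      have := ((h₀ t ht).sub ((hasDerivAt_id t).const_mul (φ₁ 0))).sub
        ((((hasDerivAt_id t).pow 2).const_mul (φ₂ 0)).div_const 2)
      refine this.congr_deriv ?_
      simp
      ring)
    (fun t ht => by simpa using e₁ t ht) 1 (by simp)
  refine le_of_eq_of_le ?_ e₀
  congr 1
  ring

theorem abs_coord_le_norm {ι : Type*} [Fintype ι] (h : EuclideanSpace ℝ ι) (j : ι) :
    |h j| ≤ ‖h‖ := by
  simpa using PiLp.norm_apply_le h j

/-- Second order Taylor expansion of a `C³` function with bounded third partial derivatives. -/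
theorem abs_taylor_pderiv_le {F : Param p q → ℝ} {N : Set (Param p q)} (hN : IsOpen N)
    (hF : ContDiffOn ℝ 3 F N) {x h : Param p q}
    (hseg : ∀ t ∈ Set.Icc (0 : ℝ) 1, x + t • h ∈ N) {B : ℝ}
    (hB : ∀ θ ∈ N, ∀ j k l, |pderiv l (pderiv k (pderiv j F)) θ| ≤ B) :
    |F (x + h) - F x - ∑ j, h j * pderiv j F x
      - (∑ j, ∑ k, h j * h k * pderiv k (pderiv j F) x) / 2|
      ≤ (Fintype.card (Unit ⊕ Fin p ⊕ Fin q) : ℝ) ^ 3 * ‖h‖ ^ 3 * B := by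
  have c1 : ∀ j, ContDiffOn ℝ 2 (pderiv j F) N := fun j =>
    contDiffOn_pderiv (n := 3) (m := 2) hN hF le_rfl j
  have c2 : ∀ j k, ContDiffOn ℝ 1 (pderiv k (pderiv j F)) N := fun j k =>
    contDiffOn_pderiv (n := 2) (m := 1) hN (c1 j) le_rfl k
  have nh : ∀ t ∈ Set.Icc (0 : ℝ) 1, N ∈ 𝓝 (x + t • h) := fun t ht =>
    hN.mem_nhds (hseg t ht)
  have d0 : ∀ t ∈ Set.Icc (0 : ℝ) 1, DifferentiableAt ℝ F (x + t • h) := fun t ht =>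
    (hF.contDiffAt (nh t ht)).differentiableAt (by norm_num)
  have d1 : ∀ j, ∀ t ∈ Set.Icc (0 : ℝ) 1, DifferentiableAt ℝ (pderiv j F) (x + t • h) :=
    fun j t ht => ((c1 j).contDiffAt (nh t ht)).differentiableAt (by norm_num)
  have d2 : ∀ j k, ∀ t ∈ Set.Icc (0 : ℝ) 1,
      DifferentiableAt ℝ (pderiv k (pderiv j F)) (x + t • h) :=
    fun j k t ht => ((c2 j k).contDiffAt (nh t ht)).differentiableAt (by norm_num)
  have key := abs_taylor_le_of_abs_deriv_le (φ := fun t => F (x + t • h))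
    (φ₁ := fun t => ∑ j, h j * pderiv j F (x + t • h))
    (φ₂ := fun t => ∑ j, h j * ∑ k, h k * pderiv k (pderiv j F) (x + t • h))
    (φ₃ := fun t => ∑ j, h j * ∑ k, h k * ∑ l, h l *
      pderiv l (pderiv k (pderiv j F)) (x + t • h))
    (K := (Fintype.card (Unit ⊕ Fin p ⊕ Fin q) : ℝ) ^ 3 * ‖h‖ ^ 3 * B)
    (fun t ht => hasDerivAt_comp_line (d0 t ht))
    (fun t ht => HasDerivAt.fun_sum fun j _ =>
      (hasDerivAt_comp_line (d1 j t ht)).const_mul (h j))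
    (fun t ht => HasDerivAt.fun_sum fun j _ => HasDerivAt.const_mul (h j) <|
      HasDerivAt.fun_sum fun k _ => (hasDerivAt_comp_line (d2 j k t ht)).const_mul (h k))
    (fun t ht => by
      -- Each of the three nested sums costs a factor d‖h‖, which gives d³‖h‖³B.
      have hsum : ∀ (f : Unit ⊕ Fin p ⊕ Fin q → ℝ) (c : ℝ), (∀ j, |f j| ≤ c) →
          |∑ j, h j * f j| ≤ (Fintype.card (Unit ⊕ Fin p ⊕ Fin q) : ℝ) * (‖h‖ * c) := by
        intro f c hf
        refine (Finset.abs_sum_le_sum_abs _ _).trans ?_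
        refine (Finset.sum_le_card_nsmul _ _ (‖h‖ * c) fun j _ => ?_).trans_eq ?_
        · rw [abs_mul]
          exact mul_le_mul (abs_coord_le_norm h j) (hf j) (abs_nonneg _) (norm_nonneg _)
        · rw [nsmul_eq_mul, Finset.card_univ]
      refine (hsum _ _ fun j => hsum _ _ fun k => hsum _ B fun l => hB _ (hseg t ht) j k l).trans_eq
        ?_
      ring)
  refine le_of_eq_of_le ?_ key
  simp only [one_smul, zero_smul, add_zero, Finset.mul_sum, mul_assoc]

/-- Both differentiations of ∑ exp L = 1 have this shape, first with G = 1 and then with G = ∂_j L.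
-/
theorem pderiv_exp_mul {L G : Param p q → ℝ} {x : Param p q} (hL : DifferentiableAt ℝ L x)
    (hG : DifferentiableAt ℝ G x) (k : Unit ⊕ Fin p ⊕ Fin q) :
    pderiv k (fun θ => Real.exp (L θ) * G θ) x
      = Real.exp (L x) * (pderiv k G x + G x * pderiv k L x) := by
  have := (hL.hasFDerivAt.exp.mul hG.hasFDerivAt).fderiv
  unfold pderiv
  rw [show (fun θ => Real.exp (L θ) * G θ) = (fun θ => Real.exp (L θ)) * G from rfl, this]
  simp
  ring

theorem pderiv_sum {ι : Type*} (s : Finset ι) {F : ι → Param p q → ℝ} {x : Param p q}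
    (hF : ∀ i ∈ s, DifferentiableAt ℝ (F i) x) (k : Unit ⊕ Fin p ⊕ Fin q) :
    pderiv k (fun θ => ∑ i ∈ s, F i θ) x = ∑ i ∈ s, pderiv k (F i) x := by
  unfold pderiv
  rw [fderiv_fun_sum hF]
  simp

theorem pderiv_eq_zero_of_eqOn_const {F : Param p q → ℝ} {N : Set (Param p q)} (hN : IsOpen N)
    {c : ℝ} (h : ∀ θ ∈ N, F θ = c) {x : Param p q} (hx : x ∈ N) (k : Unit ⊕ Fin p ⊕ Fin q) :
    pderiv k F x = 0 := by
  have : F =ᶠ[𝓝 x] fun _ => c := by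
    filter_upwards [hN.mem_nhds hx] with θ hθ using h θ hθ
  unfold pderiv
  rw [this.fderiv_eq]
  simp

/-- Differentiating `∑ f = 1`: the score has mean zero. -/
theorem sum_exp_mul_pderiv_eq_zero {ι : Type*} [Fintype ι] {L : ι → Param p q → ℝ}
    {N : Set (Param p q)} (hN : IsOpen N) (hL : ∀ i, ContDiffOn ℝ 3 (L i) N)
    (h1 : ∀ θ ∈ N, ∑ i, Real.exp (L i θ) = 1) {x : Param p q} (hx : x ∈ N)
    (j : Unit ⊕ Fin p ⊕ Fin q) :
    ∑ i, Real.exp (L i x) * pderiv j (L i) x = 0 := by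
  have d0 : ∀ i, DifferentiableAt ℝ (L i) x := fun i =>
    ((hL i).contDiffAt (hN.mem_nhds hx)).differentiableAt (by norm_num)
  have h := pderiv_eq_zero_of_eqOn_const hN (F := fun θ => ∑ i, Real.exp (L i θ) * 1)
    (c := 1) (by simpa using h1) hx j
  rw [pderiv_sum _ fun i _ => (d0 i).exp.mul_const 1] at h
  rw [← h]
  refine Finset.sum_congr rfl fun i _ => ?_
  rw [pderiv_exp_mul (d0 i) (differentiableAt_const 1)]
  simp [pderiv]

/-- Differentiating `∑ f = 1` twice: the second Bartlett identity. -/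
theorem sum_exp_mul_pderiv_pderiv_eq_zero {ι : Type*} [Fintype ι] {L : ι → Param p q → ℝ}
    {N : Set (Param p q)} (hN : IsOpen N) (hL : ∀ i, ContDiffOn ℝ 3 (L i) N)
    (h1 : ∀ θ ∈ N, ∑ i, Real.exp (L i θ) = 1) {x : Param p q} (hx : x ∈ N)
    (j k : Unit ⊕ Fin p ⊕ Fin q) :
    ∑ i, Real.exp (L i x) *
      (pderiv k (pderiv j (L i)) x + pderiv j (L i) x * pderiv k (L i) x) = 0 := by
  have d0 : ∀ i, DifferentiableAt ℝ (L i) x := fun i =>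
    ((hL i).contDiffAt (hN.mem_nhds hx)).differentiableAt (by norm_num)
  have d1 : ∀ i, DifferentiableAt ℝ (pderiv j (L i)) x := fun i =>
    ((contDiffOn_pderiv (n := 3) (m := 2) hN (hL i) le_rfl j).contDiffAt
      (hN.mem_nhds hx)).differentiableAt (by norm_num)
  have h := pderiv_eq_zero_of_eqOn_const hN
    (F := fun θ => ∑ i, Real.exp (L i θ) * pderiv j (L i) θ)
    (c := 0) (fun θ hθ => sum_exp_mul_pderiv_eq_zero hN hL h1 hθ j) hx k
  rw [pderiv_sum _ fun i _ => (d0 i).exp.fun_mul (d1 i)] at h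
  rw [← h]
  exact Finset.sum_congr rfl fun i _ => (pderiv_exp_mul (d0 i) (d1 i) k).symm

end Calculus

/-! ### The model: measurability, positivity, and the law of an observation. -/

namespace MisclassModel

variable {p q : ℕ} (M : MisclassModel p q)

/-- The image of (0,1) under the continuous link is an interval, on which the inverse is monotone or
antitone. Off the image `Function.invFunOn` returns one fixed default value. -/
theorem measurable_invFunOn_link :
    Measurable (Function.invFunOn M.link (Set.Ioo 0 1)) := by
  set u := Function.invFunOn M.link (Set.Ioo 0 1) with hu
  set R := M.link '' Set.Ioo 0 1 with hR
  have hord : R.OrdConnected :=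
    (isPreconnected_Ioo.image _ M.link_differentiable.continuousOn).ordConnected
  have hmem : ∀ b ∈ R, u b ∈ Set.Ioo (0 : ℝ) 1 ∧ M.link (u b) = b := fun b hb =>
    ⟨Function.invFunOn_mem hb, Function.invFunOn_eq hb⟩
  refine measurable_of_restrict_of_restrict_compl hord.measurableSet ?_ ?_
  · rcases M.link_monotone with h | h
    · refine Monotone.measurable fun a b hab => ?_
      by_contra hlt
      have := h (hmem b b.2).1 (hmem a a.2).1 (not_le.1 hlt)
      rw [(hmem b b.2).2, (hmem a a.2).2] at this
      exact absurd (Subtype.coe_le_coe.2 hab) (not_le.2 this)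
    · refine Antitone.measurable fun a b hab => ?_
      by_contra hlt
      have := h (hmem a a.2).1 (hmem b b.2).1 (not_le.1 hlt)
      rw [(hmem b b.2).2, (hmem a a.2).2] at this
      exact absurd (Subtype.coe_le_coe.2 hab) (not_le.2 this)
  · have : ∃ c, ∀ b : (Rᶜ : Set ℝ), u b = c :=
      ⟨_, fun b => Function.invFunOn_neg b.2⟩
    obtain ⟨c, hc⟩ := this
    rw [show Set.domRestrict Rᶜ u = fun _ => c from funext hc]
    exact measurable_const

theorem measurable_mu (θ : Param p q) : Measurable (M.mu θ) := by
  refine M.measurable_invFunOn_link.comp ?_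
  unfold linPred
  fun_prop

theorem measurable_gamma01 (θ : Param p q) : Measurable (M.gamma01 θ) :=
  continuous_sigmoid.measurable.comp (M.measurable_g₀ θ.nu)

theorem measurable_gamma10 (θ : Param p q) : Measurable (M.gamma10 θ) :=
  continuous_sigmoid.measurable.comp (M.measurable_g₁ θ.nu)

theorem measurable_a0 (θ : Param p q) (ys : Bool) : Measurable (M.a0 θ ys) := by
  cases ys
  · exact measurable_const.sub (M.measurable_gamma01 θ)
  · exact M.measurable_gamma01 θ

theorem measurable_a1 (θ : Param p q) (ys : Bool) : Measurable (M.a1 θ ys) := by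
  cases ys
  · exact M.measurable_gamma10 θ
  · exact measurable_const.sub (M.measurable_gamma10 θ)

theorem measurable_densV (θ : Param p q) (y ys : Bool) : Measurable (M.densV θ y ys) := by
  cases y
  · exact (measurable_const.sub (M.measurable_mu θ)).mul (M.measurable_a0 θ ys)
  · exact (M.measurable_mu θ).mul (M.measurable_a1 θ ys)

theorem measurable_densM (θ : Param p q) (ys : Bool) : Measurable (M.densM θ ys) := by
  have : Measurable (M.muStar θ) :=
    (M.measurable_gamma01 θ).add (((measurable_const.sub (M.measurable_gamma01 θ)).sub
      (M.measurable_gamma10 θ)).mul (M.measurable_mu θ))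
  cases ys
  · exact measurable_const.sub this
  · exact this

theorem measurable_logV (θ : Param p q) : Measurable fun o => M.logV o θ := by
  refine measurable_from_prod_countable_right fun y => ?_
  refine measurable_from_prod_countable_right fun ys => ?_
  exact (M.measurable_densV θ y ys).log

theorem measurable_logM (θ : Param p q) : Measurable fun o => M.logM o θ := by
  refine measurable_from_prod_countable_right fun y => ?_
  refine measurable_from_prod_countable_right fun ys => ?_
  exact (M.measurable_densM θ ys).log

theorem mu_mem_Ioo {θ : Param p q} {z : Fin p → ℝ}
    (h : linPred θ z ∈ M.link '' Set.Ioo 0 1) : M.mu θ z ∈ Set.Ioo (0 : ℝ) 1 :=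
  Function.invFunOn_mem h

theorem gamma01_mem_Ioo (θ : Param p q) (z : Fin p → ℝ) : M.gamma01 θ z ∈ Set.Ioo (0 : ℝ) 1 :=
  ⟨Real.sigmoid_pos _, Real.sigmoid_lt_one _⟩

theorem gamma10_mem_Ioo (θ : Param p q) (z : Fin p → ℝ) : M.gamma10 θ z ∈ Set.Ioo (0 : ℝ) 1 :=
  ⟨Real.sigmoid_pos _, Real.sigmoid_lt_one _⟩

theorem a0_mem_Ioo (θ : Param p q) (ys : Bool) (z : Fin p → ℝ) :
    M.a0 θ ys z ∈ Set.Ioo (0 : ℝ) 1 := by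
  have := M.gamma01_mem_Ioo θ z
  cases ys <;> simp_all [a0]

theorem a1_mem_Ioo (θ : Param p q) (ys : Bool) (z : Fin p → ℝ) :
    M.a1 θ ys z ∈ Set.Ioo (0 : ℝ) 1 := by
  have := M.gamma10_mem_Ioo θ z
  cases ys <;> simp_all [a1]

theorem densV_pos {θ : Param p q} {z : Fin p → ℝ} (h : linPred θ z ∈ M.link '' Set.Ioo 0 1)
    (y ys : Bool) : 0 < M.densV θ y ys z := by
  have hm := M.mu_mem_Ioo h
  cases y
  · exact mul_pos (sub_pos.2 hm.2) (M.a0_mem_Ioo θ ys z).1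
  · exact mul_pos hm.1 (M.a1_mem_Ioo θ ys z).1

/-- Summing out the true response. Through this, functions of the surrogate alone can be averaged
against the joint density. -/
theorem densM_eq_add (θ : Param p q) (ys : Bool) (z : Fin p → ℝ) :
    M.densM θ ys z = M.densV θ true ys z + M.densV θ false ys z := by
  cases ys <;> simp [densM, densV, muStar, a0, a1] <;> ring

theorem densM_pos {θ : Param p q} {z : Fin p → ℝ} (h : linPred θ z ∈ M.link '' Set.Ioo 0 1)
    (ys : Bool) : 0 < M.densM θ ys z := by
  rw [densM_eq_add]
  exact add_pos (M.densV_pos h _ _) (M.densV_pos h _ _)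

theorem sum_densM (θ : Param p q) (z : Fin p → ℝ) : ∑ ys, M.densM θ ys z = 1 := by
  simp [densM]

theorem sum_densV (θ : Param p q) (z : Fin p → ℝ) :
    ∑ c : Bool × Bool, M.densV θ c.1 c.2 z = 1 := by
  rw [← M.sum_densM θ z, Fintype.sum_prod_type_right]
  refine Finset.sum_congr rfl fun ys _ => ?_
  rw [densM_eq_add]
  simp

/-- The probability of a binary outcome, from the conditional probability of the value `true`. -/
theorem setIntegral_bool_eq {Ω : Type*} {m m0 : MeasurableSpace Ω} {μ : Measure Ω}
    [IsProbabilityMeasure μ] (hm : m ≤ m0) {T : Ω → Bool} (hT : Measurable T) {f : Ω → ℝ}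
    (hf : μ⟦{ω | T ω = true} | m⟧ =ᵐ[μ] f) (hfi : Integrable f μ) {S : Set Ω}
    (hS : MeasurableSet[m] S) (b : Bool) :
    μ.real ({ω | T ω = b} ∩ S) = ∫ ω in S, (if b then f ω else 1 - f ω) ∂μ := by
  have hTm : MeasurableSet {ω | T ω = true} := hT (measurableSet_singleton true)
  have htrue : μ.real ({ω | T ω = true} ∩ S) = ∫ ω in S, f ω ∂μ := by
    rw [← setIntegral_congr_ae₀ (hm _ hS).nullMeasurableSet
        (hf.mono fun ω h _ => h), setIntegral_condExp hm _ hS,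
      integral_indicator hTm, Measure.restrict_restrict hTm]
    · simp [measureReal_def]
    · exact (integrable_const 1).indicator hTm
  cases b
  · have hc : {ω | T ω = false} ∩ S = S \ ({ω | T ω = true} ∩ S) := by
      ext ω
      by_cases h : T ω = true <;> simp [h]
    rw [hc, measureReal_sdiff Set.inter_subset_right (hTm.inter (hm _ hS)), htrue]
    simp only [Bool.false_eq_true, if_false]
    rw [integral_sub (integrable_const 1).integrableOn hfi.integrableOn]
    simp
  · simpa using htrue

/-- The σ-algebra generated by the covariates. -/
abbrev covariateSpace (p : ℕ) : MeasurableSpace (Obs p) :=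
  MeasurableSpace.comap (fun o : Obs p => o.2.2) inferInstance

/-- The σ-algebra generated by the true response and the covariates. -/
abbrev responseCovariateSpace (p : ℕ) : MeasurableSpace (Obs p) :=
  MeasurableSpace.comap (fun o : Obs p => (o.1, o.2.2)) inferInstance

/-- Under the model, the joint law of the two responses given the covariates is `f(y, y* | z)`. -/
theorem Follows.real_eq_integral {θ : Param p q} {D : Measure (Obs p)} [IsProbabilityMeasure D]
    (hD : M.Follows θ D) (y ys : Bool)
    {A : Set (Fin p → ℝ)} (hA : MeasurableSet A) :
    D.real {o | o.1 = y ∧ o.2.1 = ys ∧ o.2.2 ∈ A}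
      = ∫ o in {o | o.2.2 ∈ A}, M.densV θ y ys o.2.2 ∂D := by
  have hZle : covariateSpace p ≤ (inferInstance : MeasurableSpace (Obs p)) :=
    Measurable.comap_le (f := fun o : Obs p => o.2.2) (measurable_snd.comp measurable_snd)
  have hYZle : responseCovariateSpace p ≤ (inferInstance : MeasurableSpace (Obs p)) :=
    Measurable.comap_le (f := fun o : Obs p => (o.1, o.2.2))
      (measurable_fst.prodMk (measurable_snd.comp measurable_snd))
  have hZ : Measurable fun o : Obs p => o.2.2 := measurable_snd.comp measurable_snd
  have hZZ : Measurable[covariateSpace p] fun o : Obs p => o.2.2 := comap_measurable _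
  have hAZ : MeasurableSet[covariateSpace p] {o : Obs p | o.2.2 ∈ A} := hZZ hA
  have hym : MeasurableSet {o : Obs p | o.1 = y} := measurable_fst (measurableSet_singleton y)
  set a : (Fin p → ℝ) → ℝ := fun z => if y then M.a1 θ ys z else M.a0 θ ys z with ha
  have ham : Measurable a := by
    cases y
    · exact M.measurable_a0 θ ys
    · exact M.measurable_a1 θ ys
  have hab : ∀ z, a z ∈ Set.Ioo (0 : ℝ) 1 := by
    intro z
    cases y
    · exact M.a0_mem_Ioo θ ys z
    · exact M.a1_mem_Ioo θ ys z
  -- Conditioning in two stages: given (Y, Z) the surrogate contributes the factor a(Z). Afterwards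
  -- a(Z) is pulled out of the conditional expectation given Z, and the response contributes μ(Z) or
  -- 1 - μ(Z).
  have hsur : D.real {o | o.1 = y ∧ o.2.1 = ys ∧ o.2.2 ∈ A}
      = ∫ o in {o | o.1 = y ∧ o.2.2 ∈ A}, a o.2.2 ∂D := by
    have hS : MeasurableSet[responseCovariateSpace p] {o : Obs p | o.1 = y ∧ o.2.2 ∈ A} :=
      ⟨{y} ×ˢ A, (measurableSet_singleton y).prod hA, by ext; simp⟩
    have hfm : Measurable fun o : Obs p =>
        if o.1 then 1 - M.gamma10 θ o.2.2 else M.gamma01 θ o.2.2 := by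
      refine Measurable.ite (measurable_fst (measurableSet_singleton true)) ?_ ?_
      · exact measurable_const.sub ((M.measurable_gamma10 θ).comp hZ)
      · exact (M.measurable_gamma01 θ).comp hZ
    have hfi : Integrable (fun o : Obs p =>
        if o.1 then 1 - M.gamma10 θ o.2.2 else M.gamma01 θ o.2.2) D := by
      refine Integrable.of_bound hfm.aestronglyMeasurable 1 (ae_of_all _ fun o => ?_)
      have h1 := M.gamma10_mem_Ioo θ o.2.2
      have h2 := M.gamma01_mem_Ioo θ o.2.2
      rw [Real.norm_eq_abs, abs_le]
      split_ifs <;> constructor <;> linarith [h1.1, h1.2, h2.1, h2.2]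
    have := setIntegral_bool_eq hYZle (measurable_fst.comp measurable_snd) hD.surrogate hfi hS ys
    rw [show {o : Obs p | o.1 = y ∧ o.2.1 = ys ∧ o.2.2 ∈ A} =
      {o : Obs p | (Prod.fst ∘ Prod.snd) o = ys} ∩ {o | o.1 = y ∧ o.2.2 ∈ A} by
        ext o; simp; tauto, this]
    refine setIntegral_congr_fun (hYZle _ hS) fun o ho => ?_
    have hoy : o.1 = y := ho.1
    simp only [ha, hoy, a0, a1]
    cases y <;> cases ys <;> simp
  have hint : Integrable (fun o : Obs p => a o.2.2) D := by
    refine Integrable.of_bound (ham.comp hZ).aestronglyMeasurable 1 (ae_of_all _ fun o => ?_)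
    rw [Real.norm_eq_abs, abs_of_pos (hab _).1]
    exact (hab _).2.le
  have hone : Integrable ({o : Obs p | o.1 = y}.indicator fun _ => (1 : ℝ)) D :=
    (integrable_const 1).indicator hym
  have hprod : (fun o : Obs p => a o.2.2) * ({o : Obs p | o.1 = y}.indicator fun _ => (1 : ℝ))
      = {o : Obs p | o.1 = y}.indicator fun o => a o.2.2 := by
    ext o
    by_cases h : o.1 = y <;> simp [h]
  have hmuy : D⟦{o : Obs p | o.1 = y} | covariateSpace p⟧ =ᵐ[D] fun o =>
      if y then M.mu θ o.2.2 else 1 - M.mu θ o.2.2 := by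
    cases y
    · have hTm : MeasurableSet {o : Obs p | o.1 = true} :=
        measurable_fst (measurableSet_singleton true)
      have e : ({o : Obs p | o.1 = false}.indicator fun _ => (1 : ℝ)) =
          (fun _ => 1) - {o : Obs p | o.1 = true}.indicator fun _ => (1 : ℝ) := by
        ext o
        cases h : o.1 <;> simp [h]
      rw [e]
      refine (condExp_sub (integrable_const 1) ((integrable_const 1).indicator hTm) _).trans ?_
      filter_upwards [hD.response] with o ho
      rw [condExp_const hZle, Pi.sub_apply, ho]
      simp
    · simpa using hD.response
  rw [hsur, show {o : Obs p | o.1 = y ∧ o.2.2 ∈ A} = {o | o.2.2 ∈ A} ∩ {o | o.1 = y} by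
      ext; simp [and_comm], ← setIntegral_indicator hym, ← hprod,
    ← setIntegral_condExp hZle (by rw [hprod]; exact hint.indicator hym) hAZ]
  refine setIntegral_congr_ae₀ (hZ hA).nullMeasurableSet ?_
  filter_upwards [condExp_mul_of_stronglyMeasurable_left (μ := D) (m := covariateSpace p)
    (f := fun o => a o.2.2) (ham.comp hZZ).stronglyMeasurable (by rw [hprod]; exact hint.indicator hym) hone, hmuy]
    with o h1 h2 _
  rw [h1, Pi.mul_apply, h2]
  cases y <;> simp [ha, densV, mul_comm]

/-- Under the model, the law of an observation is assembled from the law of the covariates and the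
conditional density. -/
theorem Follows.eq_sum_map {θ : Param p q} {D : Measure (Obs p)} [IsProbabilityMeasure D]
    (hD : M.Follows θ D) (hr : ∀ᵐ o ∂D, linPred θ o.2.2 ∈ M.link '' Set.Ioo 0 1) :
    D = ∑ c : Bool × Bool, (D.withDensity fun o => ENNReal.ofReal (M.densV θ c.1 c.2 o.2.2)).map
      fun o => (c.1, c.2, o.2.2) := by
  ext S hS
  have hZ : Measurable fun o : Obs p => o.2.2 := measurable_snd.comp measurable_snd
  have hsec : ∀ c : Bool × Bool, MeasurableSet {z : Fin p → ℝ | (c.1, c.2, z) ∈ S} := fun c =>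
    (measurable_const.prodMk (measurable_const.prodMk measurable_id)) hS
  have hmk : ∀ c : Bool × Bool, Measurable fun o : Obs p => (c.1, c.2, o.2.2) := fun c =>
    measurable_const.prodMk (measurable_const.prodMk hZ)
  -- Each summand is the restriction of `D` to one of the four events (Y, Y*) = c, and these events
  -- partition the space.
  have hterm : ∀ c : Bool × Bool,
      ((D.withDensity fun o => ENNReal.ofReal (M.densV θ c.1 c.2 o.2.2)).map
        fun o => (c.1, c.2, o.2.2)) S = D (S ∩ {o | (o.1, o.2.1) = c}) := by
    intro c
    have hset : S ∩ {o | (o.1, o.2.1) = c} =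
        {o | o.1 = c.1 ∧ o.2.1 = c.2 ∧ o.2.2 ∈ {z : Fin p → ℝ | (c.1, c.2, z) ∈ S}} := by
      ext ⟨y, ys, z⟩
      obtain ⟨c1, c2⟩ := c
      simp only [Set.mem_inter_iff, Set.mem_ofPred_eq, Prod.mk.injEq]
      constructor
      · rintro ⟨h, rfl, rfl⟩
        exact ⟨rfl, rfl, h⟩
      · rintro ⟨rfl, rfl, h⟩
        exact ⟨h, rfl, rfl⟩
    have hi := hD.real_eq_integral M c.1 c.2 (hsec c)
    rw [Measure.map_apply (hmk c) hS, withDensity_apply _ (hmk c hS), hset,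
      ← ofReal_measureReal (measure_ne_top _ _), hi, ofReal_integral_eq_lintegral_ofReal]
    · rfl
    · refine Integrable.integrableOn (Integrable.of_bound
        ((M.measurable_densV θ c.1 c.2).comp hZ).aestronglyMeasurable 1 ?_)
      filter_upwards [hr] with o ho
      rw [Real.norm_eq_abs, abs_of_pos (M.densV_pos ho _ _), ← M.sum_densV θ o.2.2]
      exact Finset.single_le_sum (f := fun c : Bool × Bool => M.densV θ c.1 c.2 o.2.2)
        (fun c _ => (M.densV_pos ho _ _).le) (Finset.mem_univ c)
    · filter_upwards [ae_restrict_of_ae hr] with o ho using (M.densV_pos ho _ _).le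
  rw [Measure.finsetSum_apply, Finset.sum_congr rfl fun c _ => hterm c,
    ← measure_biUnion_finset]
  · congr 1
    ext o
    simp
  · intro c _ c' _ hcc
    refine Set.disjoint_left.2 fun o ho ho' => hcc ?_
    exact ho.2.symm.trans ho'.2
  · intro c _
    refine hS.inter ?_
    exact (measurable_fst.prodMk (measurable_fst.comp measurable_snd)) (measurableSet_singleton c)

/-- A function whose conditional mean given the covariates vanishes has mean zero. -/
theorem Follows.integral_eq_zero {θ : Param p q} {D : Measure (Obs p)} [IsProbabilityMeasure D]
    (hD : M.Follows θ D) (hr : ∀ᵐ o ∂D, linPred θ o.2.2 ∈ M.link '' Set.Ioo 0 1)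
    {h : Obs p → ℝ} (hh : Integrable h D)
    (h0 : ∀ᵐ o ∂D, ∑ c : Bool × Bool, M.densV θ c.1 c.2 o.2.2 * h (c.1, c.2, o.2.2) = 0) :
    ∫ o, h o ∂D = 0 := by
  have hZ : Measurable fun o : Obs p => o.2.2 := measurable_snd.comp measurable_snd
  have hmk : ∀ c : Bool × Bool, Measurable fun o : Obs p => (c.1, c.2, o.2.2) := fun c =>
    measurable_const.prodMk (measurable_const.prodMk hZ)
  have hdm : ∀ c : Bool × Bool,
      Measurable fun o : Obs p => ENNReal.ofReal (M.densV θ c.1 c.2 o.2.2) := fun c =>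
    ((M.measurable_densV θ c.1 c.2).comp hZ).ennreal_ofReal
  set ν : Bool × Bool → Measure (Obs p) := fun c =>
    (D.withDensity fun o => ENNReal.ofReal (M.densV θ c.1 c.2 o.2.2)).map
      fun o => (c.1, c.2, o.2.2) with hν
  have hDeq : D = ∑ c, ν c := hD.eq_sum_map M hr
  have hint : ∀ c, Integrable h (ν c) := by
    intro c
    -- Each component is dominated by `D`, being one summand of it.
    refine hh.mono_measure ?_
    rw [hDeq]
    exact Finset.single_le_sum (fun _ _ => Measure.zero_le _) (Finset.mem_univ c)
  have hfin : ∀ c : Bool × Bool,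
      ∀ᵐ o ∂D, ENNReal.ofReal (M.densV θ c.1 c.2 o.2.2) < ⊤ := fun c =>
    ae_of_all _ fun o => ENNReal.ofReal_lt_top
  have hint' : ∀ c : Bool × Bool,
      Integrable (fun o => M.densV θ c.1 c.2 o.2.2 * h (c.1, c.2, o.2.2)) D := by
    intro c
    have := (integrable_withDensity_iff_integrable_smul' (hdm c) (hfin c)).1
      ((integrable_map_measure (hint c).1 (hmk c).aemeasurable).1 (hint c))
    refine this.congr ?_
    filter_upwards [hr] with o ho
    simp [ENNReal.toReal_ofReal (M.densV_pos ho _ _).le]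
  have hval : ∀ c, ∫ o, h o ∂(ν c)
      = ∫ o, M.densV θ c.1 c.2 o.2.2 * h (c.1, c.2, o.2.2) ∂D := by
    intro c
    rw [integral_map (hmk c).aemeasurable (hint c).1,
      integral_withDensity_eq_integral_toReal_smul (hdm c) (hfin c)]
    refine integral_congr_ae ?_
    filter_upwards [hr] with o ho
    simp [ENNReal.toReal_ofReal (M.densV_pos ho _ _).le]
  calc ∫ o, h o ∂D = ∫ o, h o ∂(∑ c, ν c) := by rw [← hDeq]
    _ = ∑ c, ∫ o, h o ∂(ν c) := integral_finsetSum_measure fun c _ => hint c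
    _ = ∫ o, ∑ c : Bool × Bool, M.densV θ c.1 c.2 o.2.2 * h (c.1, c.2, o.2.2) ∂D := by
      rw [integral_finsetSum _ fun c _ => hint' c]
      exact Finset.sum_congr rfl fun c _ => hval c
    _ = 0 := by
      rw [integral_congr_ae (g := fun _ => 0) h0]
      simp

end MisclassModel

/-! ### Bartlett identities for the two log-densities. -/

section Bartlett

variable {p q : ℕ}

open MisclassModel

/-- The Bartlett identities: the score has mean zero, and the mean of the Hessian is minus the
information matrix. -/
structure BartlettIdentities (D : Measure (Obs p))
    (L : Obs p → Param p q → ℝ) (θ₀ : Param p q) : Prop where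
  score : ∀ j, ∫ o, pderiv j (L o) θ₀ ∂D = 0
  hessian : ∀ j k, ∫ o, pderiv k (pderiv j (L o)) θ₀ ∂D = -fisherInfo D L θ₀ j k

/-- An identity weighted by f(y, y* | z) and valid for almost every z integrates to zero under the
model. Square integrable scores make the products integrable, so the Hessian and the information can
be separated. -/
theorem BartlettIdentities.of_pointwise {M : MisclassModel p q} {D : Measure (Obs p)}
    [IsProbabilityMeasure D] {L : Obs p → Param p q → ℝ} {θ₀ : Param p q}
    {N : Set (Param p q)} (hD : M.Follows θ₀ D)
    (hr : ∀ᵐ o ∂D, linPred θ₀ o.2.2 ∈ M.link '' Set.Ioo 0 1)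
    (hL : SmoothLogDensity D L θ₀ N)
    (h1 : ∀ᵐ o ∂D, ∀ j, ∑ c : Bool × Bool,
      M.densV θ₀ c.1 c.2 o.2.2 * pderiv j (L (c.1, c.2, o.2.2)) θ₀ = 0)
    (h2 : ∀ᵐ o ∂D, ∀ j k, ∑ c : Bool × Bool,
      M.densV θ₀ c.1 c.2 o.2.2 * (pderiv k (pderiv j (L (c.1, c.2, o.2.2))) θ₀
        + pderiv j (L (c.1, c.2, o.2.2)) θ₀ * pderiv k (L (c.1, c.2, o.2.2)) θ₀) = 0) :
    BartlettIdentities D L θ₀ where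
  score j := hD.integral_eq_zero M hr ((hL.score j).integrable (by norm_num))
    (h1.mono fun o h => h j)
  hessian j k := by
    have hp := (hL.score j).integrable_mul (hL.score k)
    have := hD.integral_eq_zero M hr ((hL.hessian j k).add hp) (h2.mono fun o h => h j k)
    rw [integral_add' (hL.hessian j k) hp] at this
    simp only [fisherInfo, Matrix.of_apply]
    simp only [Pi.mul_apply] at this
    linarith

theorem bartlettIdentities_logV {M : MisclassModel p q} {D : Measure (Obs p)}
    [IsProbabilityMeasure D] {δ : ℝ} {θ₀ : Param p q} {N : Set (Param p q)}
    (hD : M.Follows θ₀ D) (hreg : RegularityConditions M D δ θ₀ N) :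
    BartlettIdentities D M.logV θ₀ := by
  have hexp : ∀ z : Fin p → ℝ, (∀ θ ∈ N, linPred θ z ∈ M.link '' Set.Ioo 0 1) →
      ∀ θ ∈ N, ∀ c : Bool × Bool,
        Real.exp (M.logV (c.1, c.2, z) θ) = M.densV θ c.1 c.2 z :=
    fun z hz θ hθ c => Real.exp_log (M.densV_pos (hz θ hθ) _ _)
  have hsum : ∀ z : Fin p → ℝ, (∀ θ ∈ N, linPred θ z ∈ M.link '' Set.Ioo 0 1) →
      ∀ θ ∈ N, ∑ c : Bool × Bool, Real.exp (M.logV (c.1, c.2, z) θ) = 1 := by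
    intro z hz θ hθ
    rw [← M.sum_densV θ z]
    exact Finset.sum_congr rfl fun c _ => hexp z hz θ hθ c
  refine BartlettIdentities.of_pointwise hD (hreg.range.mono fun o h => h θ₀ hreg.mem)
    hreg.smoothV ?_ ?_
  · filter_upwards [hreg.range, hreg.smoothV.contDiffOn] with o ho hs j
    rw [← sum_exp_mul_pderiv_eq_zero hreg.isOpen
      (L := fun c : Bool × Bool => M.logV (c.1, c.2, o.2.2))
      (fun c => hs c.1 c.2) (hsum _ ho) hreg.mem j]
    exact Finset.sum_congr rfl fun c _ => by rw [hexp _ ho θ₀ hreg.mem c]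
  · filter_upwards [hreg.range, hreg.smoothV.contDiffOn] with o ho hs j k
    rw [← sum_exp_mul_pderiv_pderiv_eq_zero hreg.isOpen
      (L := fun c : Bool × Bool => M.logV (c.1, c.2, o.2.2))
      (fun c => hs c.1 c.2) (hsum _ ho) hreg.mem j k]
    exact Finset.sum_congr rfl fun c _ => by rw [hexp _ ho θ₀ hreg.mem c]

theorem bartlettIdentities_logM {M : MisclassModel p q} {D : Measure (Obs p)}
    [IsProbabilityMeasure D] {δ : ℝ} {θ₀ : Param p q} {N : Set (Param p q)}
    (hD : M.Follows θ₀ D) (hreg : RegularityConditions M D δ θ₀ N) :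
    BartlettIdentities D M.logM θ₀ := by
  have hexp : ∀ z : Fin p → ℝ, (∀ θ ∈ N, linPred θ z ∈ M.link '' Set.Ioo 0 1) →
      ∀ θ ∈ N, ∀ ys : Bool, Real.exp (M.logM (true, ys, z) θ) = M.densM θ ys z :=
    fun z hz θ hθ ys => Real.exp_log (M.densM_pos (hz θ hθ) _)
  have hsum : ∀ z : Fin p → ℝ, (∀ θ ∈ N, linPred θ z ∈ M.link '' Set.Ioo 0 1) →
      ∀ θ ∈ N, ∑ ys : Bool, Real.exp (M.logM (true, ys, z) θ) = 1 := by
    intro z hz θ hθ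
    rw [← M.sum_densM θ z]
    exact Finset.sum_congr rfl fun ys _ => hexp z hz θ hθ ys
  -- The surrogate log-density ignores y, so `true` serves as a dummy value and the sum over y
  -- collapses to the marginal density.
  have hmarg : ∀ (z : Fin p → ℝ) (G : (Param p q → ℝ) → ℝ),
      ∑ c : Bool × Bool, M.densV θ₀ c.1 c.2 z * G (M.logM (c.1, c.2, z))
        = ∑ ys : Bool, M.densM θ₀ ys z * G (M.logM (true, ys, z)) := by
    intro z G
    rw [Fintype.sum_prod_type_right]
    refine Finset.sum_congr rfl fun ys _ => ?_
    rw [densM_eq_add, add_mul, Fintype.sum_bool]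
    rfl
  refine BartlettIdentities.of_pointwise hD (hreg.range.mono fun o h => h θ₀ hreg.mem)
    hreg.smoothM ?_ ?_
  · filter_upwards [hreg.range, hreg.smoothM.contDiffOn] with o ho hs j
    rw [hmarg o.2.2 fun F => pderiv j F θ₀, ← sum_exp_mul_pderiv_eq_zero hreg.isOpen
      (L := fun ys : Bool => M.logM (true, ys, o.2.2))
      (fun ys => hs true ys) (hsum _ ho) hreg.mem j]
    exact Finset.sum_congr rfl fun c _ => by rw [hexp _ ho θ₀ hreg.mem c]
  · filter_upwards [hreg.range, hreg.smoothM.contDiffOn] with o ho hs j k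
    rw [hmarg o.2.2 fun F => pderiv k (pderiv j F) θ₀ + pderiv j F θ₀ * pderiv k F θ₀,
      ← sum_exp_mul_pderiv_pderiv_eq_zero hreg.isOpen
      (L := fun ys : Bool => M.logM (true, ys, o.2.2))
      (fun ys => hs true ys) (hsum _ ho) hreg.mem j k]
    exact Finset.sum_congr rfl fun c _ => by rw [hexp _ ho θ₀ hreg.mem c]

end Bartlett

/-! ### Tail bounds for sums over an independently selected subset. -/

section RandomSubset

variable {Ω S : Type*} [MeasurableSpace Ω] [MeasurableSpace S] {P : Measure Ω}
  {D : Measure S} {X : ℕ → Ω → S}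

/-- A tail bound for all sums over fixed subsets carries over to a random subset selected
independently of the data. -/
theorem measureReal_randomSum_le [IsProbabilityMeasure P] {n : ℕ} {W : Ω → Finset ℕ}
    (hW : Measurable W) (hWs : ∀ ω, W ω ⊆ Finset.range n)
    (hWi : IndepFun W (fun ω (i : Fin n) => X i ω) P) {h : S → ℝ} (hh : Measurable h) {t b : ℝ}
    (hb : ∀ v ⊆ Finset.range n, P.real {ω | t ≤ |∑ i ∈ v, h (X i ω)|} ≤ b) :
    P.real {ω | t ≤ |∑ i ∈ W ω, h (X i ω)|} ≤ b := by
  have hb0 : 0 ≤ b := measureReal_nonneg.trans (hb ∅ (Finset.empty_subset _))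
  have hWv : ∀ v, MeasurableSet {ω | W ω = v} := fun v => hW (measurableSet_singleton v)
  have hind : ∀ v ⊆ Finset.range n, P.real ({ω | W ω = v} ∩ {ω | t ≤ |∑ i ∈ v, h (X i ω)|})
      ≤ P.real {ω | W ω = v} * b := by
    intro v hv
    -- The event for a fixed subset v is rewritten as a condition on the first n observations only,
    -- since the selection is independent of just these.
    set A : Set (Fin n → S) := {x | t ≤ |∑ i : Fin n, if (i : ℕ) ∈ v then h (x i) else 0|}
      with hA
    have hAm : MeasurableSet A := by
      refine measurableSet_le measurable_const (Measurable.abs ?_)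
      refine Finset.measurable_sum _ fun i _ => ?_
      by_cases hi : (i : ℕ) ∈ v
      · simp only [hi, if_true]
        exact hh.comp (measurable_pi_apply i)
      · simp [hi]
    have hpre : (fun ω (i : Fin n) => X i ω) ⁻¹' A = {ω | t ≤ |∑ i ∈ v, h (X i ω)|} := by
      ext ω
      simp only [hA, Set.mem_preimage, Set.mem_ofPred_eq]
      rw [← Finset.sum_range (fun i => if i ∈ v then h (X i ω) else 0), ← Finset.sum_filter,
        Finset.filter_mem_eq_inter, Finset.inter_eq_right.2 hv]
    have := hWi.measure_inter_preimage_eq_mul {v} A (measurableSet_singleton v) hAm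
    rw [hpre] at this
    have h2 : P.real ({ω | W ω = v} ∩ {ω | t ≤ |∑ i ∈ v, h (X i ω)|})
        = P.real {ω | W ω = v} * P.real {ω | t ≤ |∑ i ∈ v, h (X i ω)|} := by
      rw [measureReal_def, measureReal_def, measureReal_def, ← ENNReal.toReal_mul]
      exact congrArg ENNReal.toReal this
    rw [h2]
    exact mul_le_mul_of_nonneg_left (hb v hv) measureReal_nonneg
  -- Splitting over the values of `W`: the probabilities of the disjoint events W = v sum to at most
  -- one, so the uniform bound survives averaging.
  have hsub : {ω | t ≤ |∑ i ∈ W ω, h (X i ω)|} ⊆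
      ⋃ v ∈ (Finset.range n).powerset, {ω | W ω = v} ∩ {ω | t ≤ |∑ i ∈ v, h (X i ω)|} := by
    intro ω hω
    simp only [Set.mem_iUnion]
    exact ⟨W ω, Finset.mem_powerset.2 (hWs ω), rfl, hω⟩
  calc P.real {ω | t ≤ |∑ i ∈ W ω, h (X i ω)|}
      ≤ P.real (⋃ v ∈ (Finset.range n).powerset,
          {ω | W ω = v} ∩ {ω | t ≤ |∑ i ∈ v, h (X i ω)|}) := measureReal_mono hsub (measure_ne_top _ _)
    _ ≤ ∑ v ∈ (Finset.range n).powerset,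
          P.real ({ω | W ω = v} ∩ {ω | t ≤ |∑ i ∈ v, h (X i ω)|}) :=
        measureReal_biUnion_finset_le _ _
    _ ≤ ∑ v ∈ (Finset.range n).powerset, P.real {ω | W ω = v} * b :=
        Finset.sum_le_sum fun v hv => hind v (Finset.mem_powerset.1 hv)
    _ = P.real (⋃ v ∈ (Finset.range n).powerset, {ω | W ω = v}) * b := by
        rw [← Finset.sum_mul, measureReal_biUnion_finset]
        · intro v _ w _ hvw
          exact Set.disjoint_left.2 fun ω h1 h2 => hvw (h1.symm.trans h2)
        · exact fun v _ => hWv v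
    _ ≤ 1 * b := mul_le_mul_of_nonneg_right measureReal_le_one hb0
    _ = b := one_mul b

/-- Chebyshev's inequality for sums over a fixed subset. -/
theorem measureReal_sum_ge_le [IsProbabilityMeasure P] (hX : ∀ i, HasLaw (X i) D P) (hi : iIndepFun X P) {h : S → ℝ}
    (hh : Measurable h) (h2 : MemLp h 2 D) (h0 : ∫ x, h x ∂D = 0) {n : ℕ} {v : Finset ℕ}
    (hv : v ⊆ Finset.range n) {t : ℝ} (ht : 0 < t) :
    P.real {ω | t ≤ |∑ i ∈ v, h (X i ω)|} ≤ n * (∫ x, h x ^ 2 ∂D) / t ^ 2 := by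
  have hlaw : ∀ i, P.map (X i) = D := fun i => (hX i).map_eq
  have hmem : ∀ i, MemLp (fun ω => h (X i ω)) 2 P := fun i =>
    (show MemLp h 2 (P.map (X i)) by rwa [hlaw i]).comp_of_map (hX i).aemeasurable
  have hmean : ∀ i, ∫ ω, h (X i ω) ∂P = 0 := fun i => by
    rw [← h0, ← hlaw i, integral_map (hX i).aemeasurable hh.aestronglyMeasurable]
  have hvar : ∀ i, Var[fun ω => h (X i ω); P] = ∫ x, h x ^ 2 ∂D := fun i => by
    rw [variance_eq_integral (hmem i).aemeasurable, hmean i, ← hlaw i,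
      integral_map (hX i).aemeasurable (hh.pow_const 2).aestronglyMeasurable]
    simp
  have hsum : MemLp (∑ i ∈ v, fun ω => h (X i ω)) 2 P := memLp_finsetSum' _ fun i _ => hmem i
  have hE : ∫ ω, (∑ i ∈ v, fun ω => h (X i ω)) ω ∂P = 0 := by
    simp only [Finset.sum_apply]
    rw [integral_finsetSum _ fun i _ => (hmem i).integrable (by norm_num)]
    simp [hmean]
  have hV : Var[∑ i ∈ v, fun ω => h (X i ω); P] = v.card * ∫ x, h x ^ 2 ∂D := by
    rw [IndepFun.variance_sum (fun i _ => hmem i)]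
    · simp [hvar]
    · intro i _ j _ hij
      exact (hi.indepFun hij).comp hh hh
  have := meas_ge_le_variance_div_sq hsum ht
  rw [hE, hV] at this
  have hcard : (v.card : ℝ) ≤ n := by
    exact_mod_cast (Finset.card_le_card hv).trans_eq (Finset.card_range n)
  have hnn : 0 ≤ ∫ x, h x ^ 2 ∂D := integral_nonneg fun x => sq_nonneg _
  calc P.real {ω | t ≤ |∑ i ∈ v, h (X i ω)|}
      ≤ v.card * (∫ x, h x ^ 2 ∂D) / t ^ 2 := by
        refine ENNReal.toReal_le_of_le_ofReal (by positivity) ?_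
        simpa using this
    _ ≤ n * (∫ x, h x ^ 2 ∂D) / t ^ 2 := by gcongr

/-- Markov's inequality for sums over a fixed subset. -/
theorem mul_measureReal_sum_ge_le (hX : ∀ i, HasLaw (X i) D P) {h : S → ℝ}
    (hh : Integrable h D) {n : ℕ} {v : Finset ℕ} (hv : v ⊆ Finset.range n) (t : ℝ) :
    t * P.real {ω | t ≤ |∑ i ∈ v, h (X i ω)|} ≤ n * ∫ x, |h x| ∂D := by
  have hlaw : ∀ i, P.map (X i) = D := fun i => (hX i).map_eq
  have hint : ∀ i, Integrable (fun ω => h (X i ω)) P := fun i =>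
    (show Integrable h (P.map (X i)) by rwa [hlaw i]).comp_aemeasurable (hX i).aemeasurable
  have habs : ∀ i, ∫ ω, |h (X i ω)| ∂P = ∫ x, |h x| ∂D := fun i => by
    have hm : AEStronglyMeasurable (fun x => |h x|) (P.map (X i)) := by
      rw [hlaw i]
      exact hh.abs.aestronglyMeasurable
    rw [← integral_map (hX i).aemeasurable hm, hlaw i]
  have hcard : (v.card : ℝ) ≤ n := by
    exact_mod_cast (Finset.card_le_card hv).trans_eq (Finset.card_range n)
  have hnn : 0 ≤ ∫ x, |h x| ∂D := integral_nonneg fun x => abs_nonneg _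
  have hs : Integrable (fun ω => ∑ i ∈ v, h (X i ω)) P := integrable_finsetSum _ fun i _ => hint i
  calc t * P.real {ω | t ≤ |∑ i ∈ v, h (X i ω)|}
      ≤ ∫ ω, |∑ i ∈ v, h (X i ω)| ∂P :=
        mul_meas_ge_le_integral_of_nonneg (ae_of_all _ fun ω => abs_nonneg _) hs.abs t
    _ ≤ ∫ ω, ∑ i ∈ v, |h (X i ω)| ∂P :=
        integral_mono hs.abs (integrable_finsetSum _ fun i _ => (hint i).abs)
          fun ω => Finset.abs_sum_le_sum_abs _ _
    _ = v.card * ∫ x, |h x| ∂D := by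
        rw [integral_finsetSum _ fun i _ => (hint i).abs]
        simp [habs]
    _ ≤ n * ∫ x, |h x| ∂D := by gcongr

/-- The weak law of large numbers, uniformly over all subsets of the sample. -/
theorem eventually_measureReal_sum_ge_le [IsProbabilityMeasure P] [IsProbabilityMeasure D] (hX : ∀ i, HasLaw (X i) D P)
    (hi : iIndepFun X P) {h : S → ℝ} (hint : Integrable h D)
    (h0 : ∫ x, h x ∂D = 0) {η ε : ℝ} (hη : 0 < η) (hε : 0 < ε) :
    ∀ᶠ n : ℕ in atTop, ∀ v ⊆ Finset.range n,
      P.real {ω | η * n ≤ |∑ i ∈ v, h (X i ω)|} ≤ ε := by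
  -- Only integrability is available, so h is approximated in L¹ by a simple function, recentred to
  -- mean zero. Chebyshev handles that part. The remainder has L¹ norm at most 2κ, and Markov at
  -- level ηn/2 bounds its probability by 4κ/η = ε/2. Neither bound depends on the subset.
  set κ : ℝ := η * ε / 8 with hκ
  have hκ0 : 0 < κ := by positivity
  obtain ⟨g, hg, hgm⟩ := (memLp_one_iff_integrable.2 hint).exists_simpleFunc_eLpNorm_sub_lt
    (by norm_num) (ε := ENNReal.ofReal κ) (by simpa using hκ0)
  have hgi : Integrable g D := memLp_one_iff_integrable.1 hgm
  have hdist : ∫ x, |h x - g x| ∂D ≤ κ := by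
    rw [eLpNorm_one_eq_lintegral_enorm] at hg
    have : ∫ x, |h x - g x| ∂D = (∫⁻ x, ‖(h - g) x‖ₑ ∂D).toReal := by
      rw [← integral_norm_eq_lintegral_enorm (hint.sub hgi).aestronglyMeasurable]
      rfl
    rw [this]
    exact ENNReal.toReal_le_of_le_ofReal hκ0.le hg.le
  set m : ℝ := ∫ x, g x ∂D with hm
  have hmκ : |m| ≤ κ := by
    -- Since h has mean zero, the recentring constant is no larger than the L¹ error.
    have : m = -∫ x, (h x - g x) ∂D := by rw [integral_sub hint hgi, h0]; ring
    rw [this, abs_neg]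
    exact (abs_integral_le_integral_abs).trans hdist
  have hg0i : Integrable (fun x => g x - m) D := hgi.sub (integrable_const m)
  have hg0m : Measurable fun x => g x - m := g.measurable.sub_const m
  have hg02 : MemLp (fun x => g x - m) 2 D :=
    (g.memLp_of_isFiniteMeasure 2 D).sub
      (memLp_const m)
  have hg00 : ∫ x, (g x - m) ∂D = 0 := by
    rw [integral_sub hgi (integrable_const m)]
    simp [hm]
  have hri : Integrable (fun x => h x - (g x - m)) D := hint.sub hg0i
  have hrb : ∫ x, |h x - (g x - m)| ∂D ≤ 2 * κ := by
    calc ∫ x, |h x - (g x - m)| ∂D ≤ ∫ x, (|h x - g x| + |m|) ∂D := by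
          refine integral_mono hri.abs ((hint.sub hgi).abs.add (integrable_const _)) fun x => ?_
          rw [show h x - (g x - m) = (h x - g x) + m by ring]
          exact abs_add_le _ _
      _ = ∫ x, |h x - g x| ∂D + |m| := by
          rw [integral_add (f := fun x => |h x - g x|) (hint.sub hgi).abs (integrable_const _)]
          simp
      _ ≤ 2 * κ := by linarith
  set s := ∫ x, (g x - m) ^ 2 ∂D with hs
  have hlim : Tendsto (fun n : ℕ => (s / (η / 2) ^ 2) / (n : ℝ)) atTop (𝓝 0) :=
    tendsto_const_div_atTop_nhds_zero_nat _
  filter_upwards [hlim.eventually (gt_mem_nhds (half_pos hε)), eventually_gt_atTop 0]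
    with n hn hn0 v hv
  have hnp : (0 : ℝ) < n := by exact_mod_cast hn0
  have e1 := measureReal_sum_ge_le hX hi hg0m hg02 hg00 hv (t := η / 2 * n) (by positivity)
  have e2 := mul_measureReal_sum_ge_le hX hri hv (η / 2 * n)
  have e1' : n * s / (η / 2 * n) ^ 2 = (s / (η / 2) ^ 2) / (n : ℝ) := by
    field_simp
  have e2' : P.real {ω | η / 2 * n ≤ |∑ i ∈ v, (h (X i ω) - (g (X i ω) - m))|} ≤ ε / 2 := by
    have h3 : η / 2 * n * P.real {ω | η / 2 * n ≤ |∑ i ∈ v, (h (X i ω) - (g (X i ω) - m))|}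
        ≤ η / 2 * n * (ε / 2) := by
      refine e2.trans ?_
      calc (n : ℝ) * ∫ x, |h x - (g x - m)| ∂D ≤ n * (2 * κ) := by gcongr
        _ = η / 2 * n * (ε / 2) := by rw [hκ]; ring
    exact le_of_mul_le_mul_left h3 (by positivity)
  have hsub : {ω | η * n ≤ |∑ i ∈ v, h (X i ω)|} ⊆
      {ω | η / 2 * n ≤ |∑ i ∈ v, (g (X i ω) - m)|} ∪
      {ω | η / 2 * n ≤ |∑ i ∈ v, (h (X i ω) - (g (X i ω) - m))|} := by
    intro ω hω
    simp only [Set.mem_union, Set.mem_ofPred_eq] at hω ⊢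
    by_contra! hcon
    have : ∑ i ∈ v, h (X i ω)
        = ∑ i ∈ v, (g (X i ω) - m) + ∑ i ∈ v, (h (X i ω) - (g (X i ω) - m)) := by
      rw [← Finset.sum_add_distrib]
      exact Finset.sum_congr rfl fun i _ => by ring
    rw [this] at hω
    have := abs_add_le (∑ i ∈ v, (g (X i ω) - m)) (∑ i ∈ v, (h (X i ω) - (g (X i ω) - m)))
    linarith [hcon.1, hcon.2]
  calc P.real {ω | η * n ≤ |∑ i ∈ v, h (X i ω)|}
      ≤ _ := measureReal_mono hsub
    _ ≤ _ := measureReal_union_le _ _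
    _ ≤ ε / 2 + ε / 2 := add_le_add (e1.trans (e1'.trans_le hn.le)) e2'
    _ = ε := by ring

theorem ae_forall_eq_comp (hX : ∀ i, HasLaw (X i) D P) {R : S → Prop} (hR : ∀ᵐ x ∂D, R x) :
    ∀ᵐ ω ∂P, ∀ i, R (X i ω) := by
  rw [ae_all_iff]
  intro i
  refine ae_of_ae_map (hX i).aemeasurable ?_
  rwa [(hX i).map_eq]

/-- The sums of an almost everywhere modified function are almost surely unchanged. -/
theorem measureReal_randomSum_congr (hX : ∀ i, HasLaw (X i) D P) {W : Ω → Finset ℕ}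
    {h h' : S → ℝ} (hh : h =ᵐ[D] h') (t : ℝ) :
    P.real {ω | t ≤ |∑ i ∈ W ω, h (X i ω)|} = P.real {ω | t ≤ |∑ i ∈ W ω, h' (X i ω)|} := by
  refine measureReal_congr ?_
  filter_upwards [ae_forall_eq_comp hX hh] with ω hω
  have : ∑ i ∈ W ω, h (X i ω) = ∑ i ∈ W ω, h' (X i ω) := Finset.sum_congr rfl fun i _ => hω i
  exact propext (by change t ≤ |_| ↔ t ≤ |_|; rw [this])

/-- Chebyshev's inequality for sums over a random subset selected independently of the data. -/
theorem measureReal_randomSum_ge_le [IsProbabilityMeasure P] (hX : ∀ i, HasLaw (X i) D P)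
    (hi : iIndepFun X P) {h : S → ℝ} (h2 : MemLp h 2 D) (h0 : ∫ x, h x ∂D = 0) {n : ℕ}
    {W : Ω → Finset ℕ} (hW : Measurable W) (hWs : ∀ ω, W ω ⊆ Finset.range n)
    (hWi : IndepFun W (fun ω (i : Fin n) => X i ω) P) {t : ℝ} (ht : 0 < t) :
    P.real {ω | t ≤ |∑ i ∈ W ω, h (X i ω)|} ≤ n * (∫ x, h x ^ 2 ∂D) / t ^ 2 := by
  -- Transfer to the random subset requires a genuinely measurable summand, so h is replaced by a
  -- measurable version.
  have hae : h =ᵐ[D] h2.1.mk h := h2.1.ae_eq_mk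
  have hm : Measurable (h2.1.mk h) := h2.1.stronglyMeasurable_mk.measurable
  have hsq : ∫ x, h x ^ 2 ∂D = ∫ x, h2.1.mk h x ^ 2 ∂D :=
    integral_congr_ae (hae.mono fun x hx => by simp only [hx])
  rw [measureReal_randomSum_congr hX hae, hsq]
  refine measureReal_randomSum_le hW hWs hWi hm fun v hv => ?_
  exact measureReal_sum_ge_le hX hi hm ((memLp_congr_ae hae).1 h2)
    ((integral_congr_ae hae).symm.trans h0) hv ht

/-- The weak law of large numbers over random subsets selected independently of the data. -/
theorem eventually_measureReal_randomSum_ge_le [IsProbabilityMeasure P] [IsProbabilityMeasure D]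
    (hX : ∀ i, HasLaw (X i) D P) (hi : iIndepFun X P) {h : S → ℝ} (hint : Integrable h D) (h0 : ∫ x, h x ∂D = 0) {W : ℕ → Ω → Finset ℕ}
    (hW : ∀ n, Measurable (W n)) (hWs : ∀ n ω, W n ω ⊆ Finset.range n)
    (hWi : ∀ n, IndepFun (W n) (fun ω (i : Fin n) => X i ω) P) {η ε : ℝ} (hη : 0 < η)
    (hε : 0 < ε) :
    ∀ᶠ n : ℕ in atTop, P.real {ω | η * n ≤ |∑ i ∈ W n ω, h (X i ω)|} ≤ ε := by
  have hae : h =ᵐ[D] hint.1.mk h := hint.1.ae_eq_mk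
  have hm : Measurable (hint.1.mk h) := hint.1.stronglyMeasurable_mk.measurable
  filter_upwards [eventually_measureReal_sum_ge_le hX hi ((integrable_congr hae).1 hint)
    ((integral_congr_ae hae).symm.trans h0) hη hε] with n hn
  rw [measureReal_randomSum_congr hX hae]
  exact measureReal_randomSum_le (hW n) (hWs n) (hWi n) hm hn

end RandomSubset

/-! ### Local lower bound for the penalty increment. -/

section Penalty

/-- First order lower bound for the increment of a function whose second derivative is Lipschitz. -/
theorem sub_ge_of_lipschitz_deriv_deriv {f : ℝ → ℝ} {u D ξ₀ ξ r : ℝ}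
    (hf : DifferentiableOn ℝ f (Set.Ioi u)) (hf' : DifferentiableOn ℝ (deriv f) (Set.Ioi u))
    (hlip : ∀ ξ₁ > u, ∀ ξ₂ > u, |deriv (deriv f) ξ₁ - deriv (deriv f) ξ₂| ≤ D * |ξ₁ - ξ₂|)
    (hD : 0 ≤ D) (hr : |ξ - ξ₀| ≤ r) (hu : u < ξ₀ - r) :
    -(|deriv f ξ₀| * r + (|deriv (deriv f) ξ₀| + D * r) * r ^ 2) ≤ f ξ - f ξ₀ := by
  have hr0 : 0 ≤ r := (abs_nonneg _).trans hr
  -- The hypothesis u < ξ₀ - r keeps this whole window inside the region of differentiability.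
  -- Bounding f'' there and applying the mean value inequality twice gives the quadratic term,
  -- without the factor 1/2.
  set s := Set.Icc (ξ₀ - r) (ξ₀ + r) with hs
  have hsub : ∀ x ∈ s, u < x := fun x hx => hu.trans_le hx.1
  have habs : ∀ x ∈ s, |x - ξ₀| ≤ r := fun x hx => abs_le.2 ⟨by linarith [hx.1], by linarith [hx.2]⟩
  have h0 : ξ₀ ∈ s := ⟨by linarith, by linarith⟩
  have hξ : ξ ∈ s := ⟨by linarith [(abs_le.1 hr).1], by linarith [(abs_le.1 hr).2]⟩
  have hda : ∀ x ∈ s, DifferentiableAt ℝ f x := fun x hx =>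
    hf.differentiableAt (Ioi_mem_nhds (hsub x hx))
  have hda' : ∀ x ∈ s, DifferentiableAt ℝ (deriv f) x := fun x hx =>
    hf'.differentiableAt (Ioi_mem_nhds (hsub x hx))
  have h2 : ∀ x ∈ s, ‖deriv (deriv f) x‖ ≤ |deriv (deriv f) ξ₀| + D * r := by
    intro x hx
    have h := hlip x (hsub x hx) ξ₀ (hsub ξ₀ h0)
    have h' : D * |x - ξ₀| ≤ D * r := mul_le_mul_of_nonneg_left (habs x hx) hD
    have h'' := abs_sub_abs_le_abs_sub (deriv (deriv f) x) (deriv (deriv f) ξ₀)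
    rw [Real.norm_eq_abs]
    linarith
  have h1 : ∀ x ∈ s, ‖deriv f x - deriv f ξ₀‖ ≤ (|deriv (deriv f) ξ₀| + D * r) * r := by
    intro x hx
    refine ((convex_Icc _ _).norm_image_sub_le_of_norm_deriv_le hda' h2 h0 hx).trans ?_
    rw [Real.norm_eq_abs]
    exact mul_le_mul_of_nonneg_left (habs x hx) (by positivity)
  have hder : ∀ x ∈ s, HasDerivWithinAt (fun x => f x - deriv f ξ₀ * x)
      (deriv f x - deriv f ξ₀) s x := fun x hx =>
    (((hda x hx).hasDerivAt.sub ((hasDerivAt_id x).const_mul (deriv f ξ₀))).congr_deriv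
      (by simp)).hasDerivWithinAt
  have hfin := (convex_Icc _ _).norm_image_sub_le_of_norm_hasDerivWithin_le hder h1 h0 hξ
  rw [Real.norm_eq_abs, Real.norm_eq_abs] at hfin
  have e1 : (|deriv (deriv f) ξ₀| + D * r) * r * |ξ - ξ₀|
      ≤ (|deriv (deriv f) ξ₀| + D * r) * r ^ 2 := by
    rw [pow_two, ← mul_assoc]
    exact mul_le_mul_of_nonneg_left hr (by positivity)
  have e2 : |deriv f ξ₀ * (ξ - ξ₀)| ≤ |deriv f ξ₀| * r := by
    rw [abs_mul]
    exact mul_le_mul_of_nonneg_left hr (abs_nonneg _)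
  have e3 := (abs_le.1 (hfin.trans e1)).1
  have e4 := (abs_le.1 e2).1
  linarith

variable {p q : ℕ}

theorem aSeq_nonneg (ρ : ℝ → ℝ → ℝ) (lam : ℕ → ℝ) (θ₀ : Param p q) (n : ℕ) :
    0 ≤ aSeq ρ lam θ₀ n := Real.iSup_nonneg fun _ => abs_nonneg _

theorem bSeq_nonneg (ρ : ℝ → ℝ → ℝ) (lam : ℕ → ℝ) (θ₀ : Param p q) (n : ℕ) :
    0 ≤ bSeq ρ lam θ₀ n := Real.iSup_nonneg fun _ => abs_nonneg _

theorem abs_deriv_le_aSeq (ρ : ℝ → ℝ → ℝ) (lam : ℕ → ℝ) (θ₀ : Param p q) (n : ℕ) {j : Fin p}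
    (hj : θ₀.beta j ≠ 0) : |deriv (ρ (lam n)) (|θ₀.beta j|)| ≤ aSeq ρ lam θ₀ n :=
  le_ciSup (f := fun j : {j : Fin p // θ₀.beta j ≠ 0} => |deriv (ρ (lam n)) (|θ₀.beta j.1|)|)
    (Set.finite_range _).bddAbove ⟨j, hj⟩

theorem abs_deriv_deriv_le_bSeq (ρ : ℝ → ℝ → ℝ) (lam : ℕ → ℝ) (θ₀ : Param p q) (n : ℕ) {j : Fin p}
    (hj : θ₀.beta j ≠ 0) : |deriv (deriv (ρ (lam n))) (|θ₀.beta j|)| ≤ bSeq ρ lam θ₀ n :=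
  le_ciSup (f := fun j : {j : Fin p // θ₀.beta j ≠ 0} =>
    |deriv (deriv (ρ (lam n))) (|θ₀.beta j.1|)|) (Set.finite_range _).bddAbove ⟨j, hj⟩

/-- Near the true value, the penalty can only decrease by a term controlled by `a_n` and `b_n`. -/
theorem eventually_penalty_sub_ge {θ₀ : Param p q} {ρ : ℝ → ℝ → ℝ} (hρ : IsPenalty ρ)
    {lam : ℕ → ℝ} (hlam_nonneg : ∀ n, 0 ≤ lam n) (hsmooth : PenaltySmooth ρ lam)
    (hlam : Tendsto lam atTop (𝓝 0)) :
    ∃ D : ℝ, 0 ≤ D ∧ ∃ s : ℝ, 0 < s ∧ ∀ᶠ n in atTop, ∀ h : Param p q, ‖h‖ ≤ s →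
      -(p * (aSeq ρ lam θ₀ n * ‖h‖ + (bSeq ρ lam θ₀ n + D * ‖h‖) * ‖h‖ ^ 2))
        ≤ ∑ j, ρ (lam n) |(θ₀ + h).beta j| - ∑ j, ρ (lam n) |θ₀.beta j| := by
  obtain ⟨C, D, hC, hCD⟩ := hsmooth
  -- With 2s at most every nonzero |β_{j0}|, a perturbation of size at most s leaves these
  -- coefficients at distance at least s from the origin, which exceeds C λ_n for large n.
  obtain ⟨s, hs, hsj⟩ : ∃ s : ℝ, 0 < s ∧ ∀ j, θ₀.beta j ≠ 0 → 2 * s ≤ |θ₀.beta j| := by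
    have : ∀ j, ∀ᶠ s in 𝓝[>] (0 : ℝ), θ₀.beta j ≠ 0 → 2 * s ≤ |θ₀.beta j| := by
      intro j
      by_cases hj : θ₀.beta j = 0
      · simp [hj]
      · have : (0 : ℝ) < |θ₀.beta j| / 2 := by positivity
        filter_upwards [nhdsWithin_le_nhds (gt_mem_nhds this)] with s hs _
        linarith
    obtain ⟨s, hs, h0⟩ := ((eventually_all.2 this).and self_mem_nhdsWithin).exists
    exact ⟨s, h0, hs⟩
  -- The Lipschitz constant is not assumed nonnegative, hence the absolute value.
  refine ⟨|D|, abs_nonneg _, s, hs, ?_⟩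
  have hCl : Tendsto (fun n => C * lam n) atTop (𝓝 0) := by simpa using hlam.const_mul C
  filter_upwards [hCl.eventually (gt_mem_nhds hs)] with n hn h hh
  have ha := aSeq_nonneg ρ lam θ₀ n
  have hb := bSeq_nonneg ρ lam θ₀ n
  have hterm : ∀ j, -(aSeq ρ lam θ₀ n * ‖h‖ + (bSeq ρ lam θ₀ n + |D| * ‖h‖) * ‖h‖ ^ 2)
      ≤ ρ (lam n) |(θ₀ + h).beta j| - ρ (lam n) |θ₀.beta j| := by
    intro j
    by_cases hj : θ₀.beta j = 0
    -- At a zero coefficient the penalty starts from 0 and can only increase; no smoothness at the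
    -- origin is needed.
    · rw [hj, abs_zero, hρ.zero _ (hlam_nonneg n), sub_zero]
      refine le_trans ?_ (hρ.nonneg _ (hlam_nonneg n) _ (abs_nonneg _))
      exact neg_nonpos.2 (by positivity)
    · have hr : |(|(θ₀ + h).beta j| - |θ₀.beta j|)| ≤ ‖h‖ := by
        refine (abs_abs_sub_abs_le _ _).trans ?_
        refine le_trans (le_of_eq ?_) (abs_coord_le_norm h (Sum.inr (Sum.inl j)))
        simp [Param.beta]
      obtain ⟨hd, hd', hl⟩ := hCD n
      refine le_trans ?_ (sub_ge_of_lipschitz_deriv_deriv hd hd' (D := |D|)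
        (fun ξ₁ h₁ ξ₂ h₂ => (hl ξ₁ h₁ ξ₂ h₂).trans
          (mul_le_mul_of_nonneg_right (le_abs_self D) (abs_nonneg _)))
        (abs_nonneg _) hr (by linarith [hsj j hj]))
      have e1 := abs_deriv_le_aSeq ρ lam θ₀ n hj
      have e2 := abs_deriv_deriv_le_bSeq ρ lam θ₀ n hj
      gcongr
  rw [← Finset.sum_sub_distrib]
  calc _ = ∑ _j : Fin p,
        -(aSeq ρ lam θ₀ n * ‖h‖ + (bSeq ρ lam θ₀ n + |D| * ‖h‖) * ‖h‖ ^ 2) := by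
        rw [Finset.sum_const, Finset.card_univ, Fintype.card_fin, nsmul_eq_mul]
        ring
    _ ≤ _ := Finset.sum_le_sum fun j _ => hterm j

end Penalty

/-! ### Expansion of the log-likelihood and the sphere comparison. -/

section Likelihood

variable {p q : ℕ}

/-- The sum of `f` over the validation sample and of `g` over the rest of the main study sample. -/
def obsSum {S : Type*} (n : ℕ) (v : Finset ℕ) (x : ℕ → S) (f g : S → ℝ) : ℝ :=
  ∑ i ∈ v, f (x i) + ∑ i ∈ Finset.range n \ v, g (x i)

theorem logLik_eq_obsSum (M : MisclassModel p q) (n : ℕ) (v : Finset ℕ) (x : ℕ → Obs p)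
    (θ : Param p q) :
    logLik M n v x θ = obsSum n v x (fun o => M.logV o θ) (fun o => M.logM o θ) := rfl

theorem obsSum_add {S : Type*} (n : ℕ) (v : Finset ℕ) (x : ℕ → S) (f g f' g' : S → ℝ) :
    obsSum n v x (fun o => f o + f' o) (fun o => g o + g' o)
      = obsSum n v x f g + obsSum n v x f' g' := by
  simp only [obsSum, Finset.sum_add_distrib]
  ring

theorem obsSum_mul {S : Type*} (n : ℕ) (v : Finset ℕ) (x : ℕ → S) (f g : S → ℝ) (c : ℝ) :
    obsSum n v x (fun o => c * f o) (fun o => c * g o) = c * obsSum n v x f g := by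
  simp only [obsSum, ← Finset.mul_sum]
  ring

theorem obsSum_sum {S ι : Type*} (s : Finset ι) (n : ℕ) (v : Finset ℕ) (x : ℕ → S)
    (f g : ι → S → ℝ) :
    obsSum n v x (fun o => ∑ j ∈ s, f j o) (fun o => ∑ j ∈ s, g j o)
      = ∑ j ∈ s, obsSum n v x (f j) (g j) := by
  simp only [obsSum, Finset.sum_add_distrib]
  rw [Finset.sum_comm, Finset.sum_comm (s := Finset.range n \ v)]

theorem obsSum_le {S : Type*} {n : ℕ} {v : Finset ℕ} {x : ℕ → S} {f g f' g' : S → ℝ}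
    (hf : ∀ i, f (x i) ≤ f' (x i)) (hg : ∀ i, g (x i) ≤ g' (x i)) :
    obsSum n v x f g ≤ obsSum n v x f' g' :=
  add_le_add (Finset.sum_le_sum fun i _ => hf i) (Finset.sum_le_sum fun i _ => hg i)

theorem obsSum_le_sum_abs {S : Type*} {n : ℕ} {v : Finset ℕ} (hv : v ⊆ Finset.range n) {x : ℕ → S}
    {f g : S → ℝ} : obsSum n v x f g ≤ ∑ i ∈ Finset.range n, (|f (x i)| + |g (x i)|) := by
  rw [← Finset.sum_sdiff hv, add_comm]
  refine add_le_add (Finset.sum_le_sum fun i _ => ?_) (Finset.sum_le_sum fun i _ => ?_)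
  · linarith [le_abs_self (f (x i)), abs_nonneg (g (x i))]
  · linarith [le_abs_self (g (x i)), abs_nonneg (f (x i))]

/-- The smoothness and domination properties of the two log-densities at one observation. -/
structure SmoothObs (M : MisclassModel p q) (N : Set (Param p q)) (BV BM : Obs p → ℝ)
    (o : Obs p) : Prop where
  contV : ContDiffOn ℝ 3 (M.logV o) N
  contM : ContDiffOn ℝ 3 (M.logM o) N
  thirdV : ∀ θ ∈ N, ∀ j k l, |pderiv l (pderiv k (pderiv j (M.logV o))) θ| ≤ BV o
  thirdM : ∀ θ ∈ N, ∀ j k l, |pderiv l (pderiv k (pderiv j (M.logM o))) θ| ≤ BM o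

/-- The score of the observed-data log-likelihood. -/
noncomputable def scoreSum (M : MisclassModel p q) (n : ℕ) (v : Finset ℕ) (x : ℕ → Obs p)
    (θ : Param p q) (j : Unit ⊕ Fin p ⊕ Fin q) : ℝ :=
  obsSum n v x (fun o => pderiv j (M.logV o) θ) (fun o => pderiv j (M.logM o) θ)

/-- The second partial derivatives of the observed-data log-likelihood. -/
noncomputable def hessSum (M : MisclassModel p q) (n : ℕ) (v : Finset ℕ) (x : ℕ → Obs p)
    (θ : Param p q) (j k : Unit ⊕ Fin p ⊕ Fin q) : ℝ :=
  obsSum n v x (fun o => pderiv k (pderiv j (M.logV o)) θ)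
    (fun o => pderiv k (pderiv j (M.logM o)) θ)

/-- The Taylor bound is summed observation by observation. The remainder is dominated by a sum over
the whole main sample, so its control does not involve the selection. -/
theorem logLik_taylor_le {M : MisclassModel p q} {N : Set (Param p q)} (hN : IsOpen N)
    {BV BM : Obs p → ℝ} {n : ℕ} {v : Finset ℕ} (hv : v ⊆ Finset.range n) {x : ℕ → Obs p}
    (hx : ∀ i, SmoothObs M N BV BM (x i)) {θ₀ h : Param p q}
    (hseg : ∀ t ∈ Set.Icc (0 : ℝ) 1, θ₀ + t • h ∈ N) :
    logLik M n v x (θ₀ + h) - logLik M n v x θ₀ ≤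
      ∑ j, h j * scoreSum M n v x θ₀ j + (∑ j, ∑ k, h j * h k * hessSum M n v x θ₀ j k) / 2
      + (Fintype.card (Unit ⊕ Fin p ⊕ Fin q) : ℝ) ^ 3 * ‖h‖ ^ 3
        * ∑ i ∈ Finset.range n, (|BV (x i)| + |BM (x i)|) := by
  set κ := (Fintype.card (Unit ⊕ Fin p ⊕ Fin q) : ℝ) ^ 3 * ‖h‖ ^ 3 with hκ
  have hκ0 : 0 ≤ κ := by positivity
  have hle : logLik M n v x (θ₀ + h) ≤ obsSum n v x
      (fun o => (M.logV o θ₀ + (∑ j, h j * pderiv j (M.logV o) θ₀ +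
        2⁻¹ * ∑ j, ∑ k, h j * h k * pderiv k (pderiv j (M.logV o)) θ₀)) + κ * BV o)
      (fun o => (M.logM o θ₀ + (∑ j, h j * pderiv j (M.logM o) θ₀ +
        2⁻¹ * ∑ j, ∑ k, h j * h k * pderiv k (pderiv j (M.logM o)) θ₀)) + κ * BM o) := by
    rw [logLik_eq_obsSum]
    refine obsSum_le (fun i => ?_) (fun i => ?_)
    · have := (abs_le.1 (abs_taylor_pderiv_le hN (hx i).contV hseg (hx i).thirdV)).2
      linarith
    · have := (abs_le.1 (abs_taylor_pderiv_le hN (hx i).contM hseg (hx i).thirdM)).2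
      linarith
  rw [obsSum_add, obsSum_add, obsSum_add, obsSum_mul, obsSum_mul, obsSum_sum, obsSum_sum,
    ← logLik_eq_obsSum] at hle
  have e1 : ∀ j, obsSum n v x (fun o => h j * pderiv j (M.logV o) θ₀)
      (fun o => h j * pderiv j (M.logM o) θ₀) = h j * scoreSum M n v x θ₀ j := fun j =>
    obsSum_mul _ _ _ _ _ _
  have e2 : ∀ j, obsSum n v x (fun o => ∑ k, h j * h k * pderiv k (pderiv j (M.logV o)) θ₀)
      (fun o => ∑ k, h j * h k * pderiv k (pderiv j (M.logM o)) θ₀)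
      = ∑ k, h j * h k * hessSum M n v x θ₀ j k := fun j => by
    rw [obsSum_sum]
    exact Finset.sum_congr rfl fun k _ => obsSum_mul _ _ _ _ _ _
  rw [Finset.sum_congr rfl fun j _ => e1 j, Finset.sum_congr rfl fun j _ => e2 j] at hle
  have e3 := mul_le_mul_of_nonneg_left (obsSum_le_sum_abs hv (x := x) (f := BV) (g := BM)) hκ0
  linarith

/-- A positive definite quadratic form dominates a multiple of the squared norm. -/
theorem Matrix.PosDef.exists_mul_norm_sq_le {ι : Type*} [Fintype ι]
    {A : Matrix ι ι ℝ} (hA : A.PosDef) :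
    ∃ c : ℝ, 0 < c ∧ ∀ h : EuclideanSpace ℝ ι, c * ‖h‖ ^ 2 ≤ ∑ j, ∑ k, h j * h k * A j k := by
  have hcont : Continuous fun h : EuclideanSpace ℝ ι => ∑ j, ∑ k, h j * h k * A j k := by
    fun_prop
  have hpos : ∀ h : EuclideanSpace ℝ ι, h ≠ 0 → 0 < ∑ j, ∑ k, h j * h k * A j k := by
    intro h hh
    have h0 : (h : ι → ℝ) ≠ 0 := fun h' => hh (by ext i; exact congrFun h' i)
    have := hA.dotProduct_mulVec_pos h0
    simp only [dotProduct, Matrix.mulVec, Finset.mul_sum, Pi.star_apply, star_trivial] at this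
    refine this.trans_eq (Finset.sum_congr rfl fun j _ => Finset.sum_congr rfl fun k _ => by ring)
  rcases isEmpty_or_nonempty ι with hι | hι
  · exact ⟨1, one_pos, fun h => by simp [Subsingleton.elim h 0]⟩
  have hne : (Metric.sphere (0 : EuclideanSpace ℝ ι) 1).Nonempty :=
    NormedSpace.sphere_nonempty.2 zero_le_one
  -- The constant is the minimum of the form on the unit sphere; homogeneity of degree two extends
  -- the bound to all vectors.
  obtain ⟨u, hu, hmin⟩ := (isCompact_sphere (0 : EuclideanSpace ℝ ι) 1).exists_isMinOn hne
    hcont.continuousOn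
  have hu1 : ‖u‖ = 1 := by simpa using hu
  refine ⟨_, hpos u (fun h => by simp [h] at hu1), fun h => ?_⟩
  rcases eq_or_ne h 0 with rfl | hh
  · simp
  have hn : 0 < ‖h‖ := norm_pos_iff.2 hh
  have hmem : ‖h‖⁻¹ • h ∈ Metric.sphere (0 : EuclideanSpace ℝ ι) 1 := by
    simp [norm_smul, hn.ne']
  have := hmin hmem
  simp only [Set.mem_ofPred_eq] at this
  calc _ ≤ (∑ j, ∑ k, (‖h‖⁻¹ • h) j * (‖h‖⁻¹ • h) k * A j k) * ‖h‖ ^ 2 := by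
        gcongr
    _ = ∑ j, ∑ k, h j * h k * A j k := by
        rw [Finset.sum_mul]
        refine Finset.sum_congr rfl fun j _ => ?_
        rw [Finset.sum_mul]
        refine Finset.sum_congr rfl fun k _ => ?_
        simp only [PiLp.smul_apply, smul_eq_mul]
        field_simp

/-- The limiting information matrix of the observed data. -/
noncomputable def limitInfo (M : MisclassModel p q) (D : Measure (Obs p)) (δ : ℝ)
    (θ₀ : Param p q) : Matrix (Unit ⊕ Fin p ⊕ Fin q) (Unit ⊕ Fin p ⊕ Fin q) ℝ :=
  δ • fisherInfo D M.logV θ₀ + (1 - δ) • fisherInfo D M.logM θ₀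

/-- The event on which the score, the Hessian and the third derivatives are under control. -/
structure GoodSample (M : MisclassModel p q) (N : Set (Param p q)) (BV BM : Obs p → ℝ)
    (θ₀ : Param p q) (A : Matrix (Unit ⊕ Fin p ⊕ Fin q) (Unit ⊕ Fin p ⊕ Fin q) ℝ)
    (η T : ℝ) (n : ℕ) (v : Finset ℕ) (x : ℕ → Obs p) : Prop where
  smooth : ∀ i, SmoothObs M N BV BM (x i)
  score : ∀ j, |scoreSum M n v x θ₀ j| ≤ T * √n
  hess : ∀ j k, |hessSum M n v x θ₀ j k + n * A j k| ≤ η * n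
  third : ∑ i ∈ Finset.range n, (|BV (x i)| + |BM (x i)|) ≤ T * n

theorem sum_mul_le_card_mul {ι : Type*} [Fintype ι] (h : EuclideanSpace ℝ ι) {f : ι → ℝ} {c : ℝ}
    (hf : ∀ j, |f j| ≤ c) : ∑ j, h j * f j ≤ Fintype.card ι * (‖h‖ * c) := by
  refine (Finset.sum_le_card_nsmul _ _ (‖h‖ * c) fun j _ => ?_).trans_eq ?_
  · refine (le_abs_self _).trans ?_
    rw [abs_mul]
    exact mul_le_mul (abs_coord_le_norm h j) (hf j) (abs_nonneg _) (norm_nonneg _)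
  · rw [nsmul_eq_mul, Finset.card_univ]

/-- The Hessian form is at most -cn‖h‖² plus an error d²ηn‖h‖², of which `hη` makes at most half the
main term. The Taylor factor 1/2 then leaves c/4. -/
theorem GoodSample.logLik_sub_le {M : MisclassModel p q} {N : Set (Param p q)} (hN : IsOpen N)
    {BV BM : Obs p → ℝ} {θ₀ : Param p q}
    {A : Matrix (Unit ⊕ Fin p ⊕ Fin q) (Unit ⊕ Fin p ⊕ Fin q) ℝ} {η T : ℝ} {n : ℕ}
    {v : Finset ℕ} (hv : v ⊆ Finset.range n) {x : ℕ → Obs p}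
    (hg : GoodSample M N BV BM θ₀ A η T n v x) {c : ℝ}
    (hA : ∀ h : Param p q, c * ‖h‖ ^ 2 ≤ ∑ j, ∑ k, h j * h k * A j k)
    (hη : (Fintype.card (Unit ⊕ Fin p ⊕ Fin q) : ℝ) ^ 2 * η ≤ c / 2) {h : Param p q}
    (hseg : ∀ t ∈ Set.Icc (0 : ℝ) 1, θ₀ + t • h ∈ N) :
    logLik M n v x (θ₀ + h) - logLik M n v x θ₀ ≤
      (Fintype.card (Unit ⊕ Fin p ⊕ Fin q) : ℝ) * (‖h‖ * (T * √n)) - n * (c / 4 * ‖h‖ ^ 2)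
      + (Fintype.card (Unit ⊕ Fin p ⊕ Fin q) : ℝ) ^ 3 * ‖h‖ ^ 3 * (T * n) := by
  set d := (Fintype.card (Unit ⊕ Fin p ⊕ Fin q) : ℝ) with hd
  have e0 := logLik_taylor_le hN hv hg.smooth hseg
  have e1 := sum_mul_le_card_mul h hg.score
  have e3 : d ^ 3 * ‖h‖ ^ 3 * ∑ i ∈ Finset.range n, (|BV (x i)| + |BM (x i)|)
      ≤ d ^ 3 * ‖h‖ ^ 3 * (T * n) := mul_le_mul_of_nonneg_left hg.third (by positivity)
  have hin : ∀ j, |∑ k, h k * (hessSum M n v x θ₀ j k + n * A j k)| ≤ d * (‖h‖ * (η * n)) := by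
    intro j
    refine abs_le'.2 ⟨sum_mul_le_card_mul h (hg.hess j), ?_⟩
    rw [← Finset.sum_neg_distrib]
    simp only [← mul_neg]
    exact sum_mul_le_card_mul h fun k => by rw [abs_neg]; exact hg.hess j k
  have e2 := sum_mul_le_card_mul h hin
  have e2' : ∑ j, ∑ k, h j * h k * hessSum M n v x θ₀ j k
      = ∑ j, h j * ∑ k, h k * (hessSum M n v x θ₀ j k + n * A j k)
        - n * ∑ j, ∑ k, h j * h k * A j k := by
    simp only [Finset.mul_sum, ← Finset.sum_sub_distrib]
    exact Finset.sum_congr rfl fun j _ => Finset.sum_congr rfl fun k _ => by ring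
  have e4 : (n : ℝ) * (c * ‖h‖ ^ 2) ≤ n * ∑ j, ∑ k, h j * h k * A j k :=
    mul_le_mul_of_nonneg_left (hA h) (Nat.cast_nonneg n)
  have e5 : d * (‖h‖ * (d * (‖h‖ * (η * n)))) ≤ n * (c / 2 * ‖h‖ ^ 2) := by
    have : n * ‖h‖ ^ 2 * (d ^ 2 * η) ≤ n * ‖h‖ ^ 2 * (c / 2) :=
      mul_le_mul_of_nonneg_left hη (by positivity)
    linarith
  linarith

/-- On good samples the penalized likelihood is, on a sphere of radius proportional to the rate,
smaller than at the true value. -/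
theorem eventually_penLogLik_lt {M : MisclassModel p q} {N : Set (Param p q)} (hN : IsOpen N)
    {θ₀ : Param p q} (hθ₀ : θ₀ ∈ N) {BV BM : Obs p → ℝ}
    {A : Matrix (Unit ⊕ Fin p ⊕ Fin q) (Unit ⊕ Fin p ⊕ Fin q) ℝ}
    {ρ : ℝ → ℝ → ℝ} (hρ : IsPenalty ρ) {lam : ℕ → ℝ} (hlam_nonneg : ∀ n, 0 ≤ lam n)
    (hsmooth : PenaltySmooth ρ lam) (hlam : Tendsto lam atTop (𝓝 0))
    (hb : Tendsto (bSeq ρ lam θ₀) atTop (𝓝 0)) {c η T K : ℝ} (hc : 0 < c)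
    (hA : ∀ h : Param p q, c * ‖h‖ ^ 2 ≤ ∑ j, ∑ k, h j * h k * A j k)
    (hη : (Fintype.card (Unit ⊕ Fin p ⊕ Fin q) : ℝ) ^ 2 * η ≤ c / 2) (hT : 0 ≤ T) (hK : 0 < K)
    (hTK : (Fintype.card (Unit ⊕ Fin p ⊕ Fin q) : ℝ) * T + p < c / 8 * K) {α : ℕ → ℝ}
    (hα : Tendsto α atTop (𝓝 0)) (hαn : ∀ n : ℕ, 0 < n → √n ≤ n * α n)
    (hαa : ∀ n, aSeq ρ lam θ₀ n ≤ α n) :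
    ∀ᶠ n in atTop, ∀ v ⊆ Finset.range n, ∀ x, GoodSample M N BV BM θ₀ A η T n v x →
      ∀ h : Param p q, ‖h‖ = K * α n →
        penLogLik M ρ (lam n) n v x (θ₀ + h) < penLogLik M ρ (lam n) n v x θ₀ := by
  obtain ⟨D, hD, s, hs, hpen⟩ := eventually_penalty_sub_ge (θ₀ := θ₀) hρ hlam_nonneg hsmooth hlam
  obtain ⟨r₀, hr₀, hball⟩ := Metric.isOpen_iff.1 hN θ₀ hθ₀
  set d := (Fintype.card (Unit ⊕ Fin p ⊕ Fin q) : ℝ) with hd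
  have hKα : Tendsto (fun n => K * α n) atTop (𝓝 0) := by simpa using hα.const_mul K
  -- These are the coefficients of the cubic remainder and of the second order penalty term after
  -- division by n α_n². Their limit is 0, so they eventually use up less than half of the curvature
  -- (c/4)K²; `hTK` reserves the other half for the linear terms.
  have hsmall : Tendsto (fun n => d ^ 3 * K ^ 3 * α n * T
      + p * ((bSeq ρ lam θ₀ n + D * (K * α n)) * K ^ 2)) atTop (𝓝 0) := by
    have h1 := (hα.const_mul (d ^ 3 * K ^ 3)).mul_const T
    have h2 := ((hb.add (hKα.const_mul D)).mul_const (K ^ 2)).const_mul (p : ℝ)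
    simpa using h1.add h2
  have hcK : 0 < c / 8 * K ^ 2 := by positivity
  filter_upwards [hpen, hKα.eventually (gt_mem_nhds hs), hKα.eventually (gt_mem_nhds hr₀),
    hsmall.eventually (gt_mem_nhds hcK), eventually_gt_atTop 0] with n hpn hKs hKr hsm hn0 v hv x hg
      h hh
  have hnp : (0 : ℝ) < n := by exact_mod_cast hn0
  have hαp : 0 < α n := by
    have h1 := (Real.sqrt_pos.2 hnp).trans_le (hαn n hn0)
    exact (pos_iff_pos_of_mul_pos h1).1 hnp
  have hseg : ∀ t ∈ Set.Icc (0 : ℝ) 1, θ₀ + t • h ∈ N := by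
    intro t ht
    refine hball ?_
    rw [mem_ball_iff_norm, add_sub_cancel_left, norm_smul, Real.norm_eq_abs, abs_of_nonneg ht.1]
    have : t * ‖h‖ ≤ 1 * ‖h‖ := mul_le_mul_of_nonneg_right ht.2 (norm_nonneg _)
    linarith
  have hL := hg.logLik_sub_le hN hv hA hη hseg
  have hP := mul_le_mul_of_nonneg_left (hpn h (hh.trans_lt hKs).le) hnp.le
  rw [hh] at hL hP
  set e := n * α n ^ 2 with he
  have hep : 0 < e := by positivity
  have t1 : d * (K * α n * (T * √n)) ≤ d * K * T * e := by
    have : d * (K * α n) * T * √n ≤ d * (K * α n) * T * (n * α n) :=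
      mul_le_mul_of_nonneg_left (hαn n hn0) (by positivity)
    calc _ = d * (K * α n) * T * √n := by ring
      _ ≤ _ := this
      _ = _ := by rw [he]; ring
  have t4 : n * (p * (aSeq ρ lam θ₀ n * (K * α n))) ≤ p * K * e := by
    have : n * (p * (K * α n)) * aSeq ρ lam θ₀ n ≤ n * (p * (K * α n)) * α n :=
      mul_le_mul_of_nonneg_left (hαa n) (by positivity)
    calc _ = n * (p * (K * α n)) * aSeq ρ lam θ₀ n := by ring
      _ ≤ _ := this
      _ = _ := by rw [he]; ring
  have t6 : (d * T + p) * K * e < c / 8 * K * K * e := by gcongr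
  have t7 := mul_lt_mul_of_pos_right hsm hep
  simp only [penLogLik]
  have id3 : d ^ 3 * (K * α n) ^ 3 * (T * n) = d ^ 3 * K ^ 3 * α n * T * e := by rw [he]; ring
  have id2 : n * (c / 4 * (K * α n) ^ 2) = c / 4 * K ^ 2 * e := by rw [he]; ring
  have id5 : (n : ℝ) * (p * ((bSeq ρ lam θ₀ n + D * (K * α n)) * (K * α n) ^ 2))
      = p * ((bSeq ρ lam θ₀ n + D * (K * α n)) * K ^ 2) * e := by rw [he]; ring
  rw [id3, id2] at hL
  have hP' : n * ∑ j, ρ (lam n) |θ₀.beta j| - n * ∑ j, ρ (lam n) |(θ₀ + h).beta j|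
      ≤ n * (p * (aSeq ρ lam θ₀ n * (K * α n)))
        + n * (p * ((bSeq ρ lam θ₀ n + D * (K * α n)) * (K * α n) ^ 2)) := by
    linarith
  rw [id5] at hP'
  linarith

end Likelihood

/-! ### Bookkeeping for events of small probability. -/

section Negligible

variable {Ω : Type*} [MeasurableSpace Ω] {P : Measure Ω}

/-- A family of events, indexed by a truncation level `T` and the sample size, whose probability is
eventually small for large `T`. -/
def NegligibleEvents (P : Measure Ω) (A : ℝ → ℕ → Set Ω) : Prop :=
  ∀ ε : ℝ, 0 < ε → ∀ᶠ T in atTop, ∀ᶠ n in atTop, P (A T n) ≤ ENNReal.ofReal ε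

theorem NegligibleEvents.mono {A B : ℝ → ℕ → Set Ω} (hA : NegligibleEvents P A)
    (h : ∀ᶠ T in atTop, ∀ᶠ n in atTop, B T n ⊆ A T n) : NegligibleEvents P B := by
  intro ε hε
  filter_upwards [hA ε hε, h] with T h1 h2
  filter_upwards [h1, h2] with n h3 h4
  exact (measure_mono h4).trans h3

theorem NegligibleEvents.iUnion {ι : Type*} [Fintype ι] {A : ι → ℝ → ℕ → Set Ω}
    (hA : ∀ i, NegligibleEvents P (A i)) : NegligibleEvents P fun T n => ⋃ i, A i T n := by
  intro ε hε
  -- The +1 keeps the denominator positive when the index type is empty.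
  have hε' : 0 < ε / (Fintype.card ι + 1) := by positivity
  filter_upwards [eventually_all.2 fun i => hA i _ hε'] with T hT
  filter_upwards [eventually_all.2 hT] with n hn
  calc P (⋃ i, A i T n) ≤ ∑ i, P (A i T n) := measure_iUnion_fintype_le _ _
    _ ≤ ∑ _i : ι, ENNReal.ofReal (ε / (Fintype.card ι + 1)) := Finset.sum_le_sum fun i _ => hn i
    _ = ENNReal.ofReal (Fintype.card ι * (ε / (Fintype.card ι + 1))) := by
        rw [Finset.sum_const, Finset.card_univ, nsmul_eq_mul,
          ENNReal.ofReal_mul (Nat.cast_nonneg _), ENNReal.ofReal_natCast]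
    _ ≤ ENNReal.ofReal ε := by
        refine ENNReal.ofReal_le_ofReal ?_
        rw [← mul_div_assoc, div_le_iff₀ (by positivity)]
        linarith

theorem NegligibleEvents.union {A B : ℝ → ℕ → Set Ω} (hA : NegligibleEvents P A)
    (hB : NegligibleEvents P B) : NegligibleEvents P fun T n => A T n ∪ B T n := by
  refine (NegligibleEvents.iUnion (ι := Bool) (A := fun b => if b then A else B) ?_).mono ?_
  · rintro (_ | _) <;> simpa
  · refine Eventually.of_forall fun T => Eventually.of_forall fun n ω hω => ?_
    rw [Set.mem_iUnion]
    rcases hω with h | h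
    · exact ⟨true, by simpa using h⟩
    · exact ⟨false, by simpa using h⟩

theorem NegligibleEvents.of_real_le [IsFiniteMeasure P] {A : ℝ → ℕ → Set Ω} {b : ℝ → ℝ}
    (hb : Tendsto b atTop (𝓝 0))
    (h : ∀ᶠ T in atTop, ∀ᶠ n in atTop, P.real (A T n) ≤ b T) : NegligibleEvents P A := by
  intro ε hε
  filter_upwards [h, hb.eventually (gt_mem_nhds hε)] with T h1 h2
  filter_upwards [h1] with n h3
  rw [← ofReal_measureReal (measure_ne_top _ _)]
  exact ENNReal.ofReal_le_ofReal (h3.trans h2.le)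

theorem NegligibleEvents.of_measure_eq_zero {A : ℝ → ℕ → Set Ω} (h : ∀ T n, P (A T n) = 0) :
    NegligibleEvents P A := fun ε _ =>
  Eventually.of_forall fun T => Eventually.of_forall fun n => by simp [h T n]

end Negligible

/-! ### From the sphere comparison to a measurable estimator. -/

section Estimator

/-- If, with high probability, random functions are smaller on a sphere of radius of order `α_n`
than at the centre, then they have measurable local maximizers at distance `O_p(α_n)`. -/
theorem exists_measurable_isLocalMax {Ω E : Type*} [MeasurableSpace Ω] {P : Measure Ω}
    [NormedAddCommGroup E] [ProperSpace E] [MeasurableSpace E] [BorelSpace E]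
    {Q : ℕ → Ω → E → ℝ} {θ₀ : E} {α : ℕ → ℝ} {r₀ : ℝ} (hr₀ : 0 < r₀)
    (hm : ∀ n, ∀ θ ∈ Metric.closedBall θ₀ r₀, Measurable fun ω => Q n ω θ)
    (hc : ∀ᵐ ω ∂P, ∀ n, ContinuousOn (Q n ω) (Metric.closedBall θ₀ r₀))
    (hα0 : ∀ n, 0 ≤ α n) (hα : Tendsto α atTop (𝓝 0))
    (hlt : ∀ ε : ℝ, 0 < ε → ∃ K : ℕ, ∀ᶠ n in atTop,
      P {ω | ¬ ∀ h : E, ‖h‖ = K * α n → Q n ω (θ₀ + h) < Q n ω θ₀} ≤ ENNReal.ofReal ε) :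
    ∃ est : ℕ → Ω → E, (∀ n, Measurable (est n)) ∧
      Tendsto (fun n => P {ω | ¬ IsLocalMax (Q n ω) (est n ω)}) atTop (𝓝 0) ∧
      IsBigOInProb P (fun n ω => ‖est n ω - θ₀‖) α := by
  classical
  -- A measurable null set containing all failures of continuity. On it the functions are replaced
  -- by 0, so that the measurable maximizer theorem applies for every ω.
  set Z := toMeasurable P {ω | ¬ ∀ n, ContinuousOn (Q n ω) (Metric.closedBall θ₀ r₀)} with hZ
  have hZm : MeasurableSet Z := measurableSet_toMeasurable _ _
  have hZ0 : P Z = 0 := by rw [hZ, measure_toMeasurable]; exact hc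
  have hZc : ∀ ω ∉ Z, ∀ n, ContinuousOn (Q n ω) (Metric.closedBall θ₀ r₀) := by
    intro ω hω
    by_contra hcon
    exact hω (subset_toMeasurable _ _ hcon)
  set R : ℕ → ℕ → ℝ := fun n K => min (K * α n) r₀ with hR
  have hR0 : ∀ n K, 0 ≤ R n K := fun n K => le_min (mul_nonneg (Nat.cast_nonneg _) (hα0 n)) hr₀.le
  have hsub : ∀ n K, Metric.closedBall θ₀ (R n K) ⊆ Metric.closedBall θ₀ r₀ := fun n K =>
    Metric.closedBall_subset_closedBall (min_le_right _ _)
  have hex : ∀ n K, ∃ t : Ω → E, Measurable t ∧ ∀ ω, t ω ∈ Metric.closedBall θ₀ (R n K) ∧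
      IsMaxOn (fun θ => if ω ∈ Z then 0 else Q n ω θ) (Metric.closedBall θ₀ (R n K)) (t ω) := by
    intro n K
    refine exists_measurable_argmax (isCompact_closedBall _ _)
      (Metric.nonempty_closedBall.2 (hR0 n K)) (fun θ hθ => ?_) (fun ω => ?_)
    · exact Measurable.ite hZm measurable_const (hm n θ (hsub n K hθ))
    · by_cases hω : ω ∈ Z
      · simpa [hω] using continuousOn_const
      · simpa [hω] using (hZc ω hω n).mono (hsub n K)
  choose t htm ht using hex
  set G : ℕ → ℕ → Ω → Prop := fun n K ω => ‖t n K ω - θ₀‖ < R n K with hG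
  have hGm : ∀ n K, MeasurableSet {ω | G n K ω} := fun n K =>
    measurableSet_lt (((continuous_id.sub continuous_const).norm).measurable.comp (htm n K))
      measurable_const
  -- The second alternative makes the search total: if no maximizer is interior, every K qualifies
  -- and the search returns 0.
  have hfind : ∀ n ω, ∃ K, G n K ω ∨ ∀ K', ¬ G n K' ω := by
    intro n ω
    by_cases h : ∃ K, G n K ω
    · exact ⟨h.choose, Or.inl h.choose_spec⟩
    · exact ⟨0, Or.inr (not_exists.1 h)⟩
  -- The smallest successful index is at most any successful K. One estimator, chosen without
  -- reference to ε, therefore obeys the bound for each K.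
  have hgood : ∀ n ω K, ω ∉ Z → G n K ω →
      IsLocalMax (Q n ω) (t n (Nat.find (hfind n ω)) ω) ∧
        ‖t n (Nat.find (hfind n ω)) ω - θ₀‖ ≤ K * α n := by
    intro n ω K hω hGK
    have hle : Nat.find (hfind n ω) ≤ K := Nat.find_min' _ (Or.inl hGK)
    have hGf : G n (Nat.find (hfind n ω)) ω :=
      (Nat.find_spec (hfind n ω)).resolve_right fun h => h K hGK
    generalize Nat.find (hfind n ω) = K₁ at hle hGf
    have hmax := (ht n K₁ ω).2
    simp only [hω, if_false] at hmax
    refine ⟨hmax.isLocalMax ?_, ?_⟩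
    · refine Filter.mem_of_superset ?_ Metric.ball_subset_closedBall
      exact Metric.isOpen_ball.mem_nhds (mem_ball_iff_norm.2 hGf)
    · refine hGf.le.trans ((min_le_left _ _).trans ?_)
      exact mul_le_mul_of_nonneg_right (by exact_mod_cast hle) (hα0 n)
  have hprob : ∀ ε : ℝ, 0 < ε → ∃ K : ℕ, ∀ᶠ n in atTop,
      P {ω | ω ∈ Z ∨ ¬ G n K ω} ≤ ENNReal.ofReal ε := by
    intro ε hε
    obtain ⟨K, hK⟩ := hlt ε hε
    refine ⟨K, ?_⟩
    have hKα : Tendsto (fun n => K * α n) atTop (𝓝 0) := by simpa using hα.const_mul (K : ℝ)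
    filter_upwards [hK, hKα.eventually (gt_mem_nhds hr₀)] with n hn hlt'
    have hRn : R n K = K * α n := min_eq_left hlt'.le
    have hincl : {ω | ω ∈ Z ∨ ¬ G n K ω} ⊆
        Z ∪ {ω | ¬ ∀ h : E, ‖h‖ = K * α n → Q n ω (θ₀ + h) < Q n ω θ₀} := by
      intro ω hω
      by_contra hcon
      simp only [Set.mem_union, Set.mem_ofPred_eq, not_or, not_not] at hcon
      refine (not_or.2 ⟨hcon.1, not_not.2 ?_⟩ : ¬(ω ∈ Z ∨ ¬ G n K ω)) hω
      have hmem := (ht n K ω).1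
      have hmax := (ht n K ω).2
      simp only [hcon.1, if_false] at hmax
      rw [mem_closedBall_iff_norm] at hmem
      -- A maximizer on the sphere would have a smaller value than the centre, which also lies in
      -- the ball.
      refine lt_of_le_of_ne hmem fun heq => ?_
      have h1 := hcon.2 (t n K ω - θ₀) (heq.trans hRn)
      rw [add_sub_cancel] at h1
      exact absurd (hmax (Metric.mem_closedBall_self (hR0 n K))) (not_le.2 h1)
    calc _ ≤ P (Z ∪ {ω | ¬ ∀ h : E, ‖h‖ = K * α n → Q n ω (θ₀ + h) < Q n ω θ₀}) :=
          measure_mono hincl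
      _ ≤ P Z + _ := measure_union_le _ _
      _ ≤ _ := by rw [hZ0, zero_add]; exact hn
  refine ⟨fun n ω => t n (Nat.find (hfind n ω)) ω, fun n => ?_, ?_, ?_⟩
  · refine Measurable.find (f := fun K ω => t n K ω) (fun K => htm n K) (fun K => ?_) (hfind n)
    have : MeasurableSet {ω | ∀ K', ¬ G n K' ω} := by
      simp only [Set.ofPred_forall]
      exact MeasurableSet.iInter fun K' => (hGm n K').compl
    exact (hGm n K).union this
  · rw [ENNReal.tendsto_nhds_zero]
    intro ε hε
    obtain ⟨e, he0, hee⟩ := ENNReal.lt_iff_exists_nnreal_btwn.1 hε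
    obtain ⟨K, hK⟩ := hprob e (by exact_mod_cast he0)
    filter_upwards [hK] with n hn
    rw [ENNReal.ofReal_coe_nnreal] at hn
    refine (measure_mono fun ω hω => ?_).trans (hn.trans hee.le)
    by_contra hcon
    have := not_or.1 hcon
    exact hω (hgood n ω K this.1 (not_not.1 this.2)).1
  · intro ε hε
    obtain ⟨K, hK⟩ := hprob ε hε
    refine ⟨K, ?_⟩
    filter_upwards [hK] with n hn
    refine (measure_mono fun ω hω => ?_).trans hn
    by_contra hcon
    have := not_or.1 hcon
    refine absurd (hgood n ω K this.1 (not_not.1 this.2)).2 (not_le.2 ?_)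
    simpa using hω

end Estimator

/-! ### Stochastic orders of sums over the validation design. -/

section Design

variable {p : ℕ} {Ω : Type*} [MeasurableSpace Ω] {P : Measure Ω} {D : Measure (Obs p)}
  {X : ℕ → Ω → Obs p} {nv : ℕ → ℕ} {V : ℕ → Ω → Finset ℕ}

namespace ValidationDesign

theorem measurable_compl (hdesign : ValidationDesign P D X nv V) (n : ℕ) :
    Measurable fun ω => Finset.range n \ V n ω :=
  (measurable_of_countable fun v : Finset ℕ => Finset.range n \ v).comp (hdesign.measurable_sel n)

/-- The unvalidated part is again a subset selected independently of the data, so the random subset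
bounds apply to it as well. -/
theorem indep_compl (hdesign : ValidationDesign P D X nv V) (n : ℕ) :
    IndepFun (fun ω => Finset.range n \ V n ω) (fun ω (i : Fin n) => X i ω) P :=
  (hdesign.indep_sel n).comp (measurable_of_countable fun v : Finset ℕ => Finset.range n \ v)
    measurable_id

/-- Sums of centred square integrable terms over the two parts of the sample are `O_p(√n)`. -/
theorem negligible_obsSum_sqrt [IsProbabilityMeasure P] (hdesign : ValidationDesign P D X nv V)
    {f g : Obs p → ℝ} (hf : MemLp f 2 D) (hg : MemLp g 2 D) (hf0 : ∫ o, f o ∂D = 0)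
    (hg0 : ∫ o, g o ∂D = 0) :
    NegligibleEvents P fun T n =>
      {ω | T * √n < |obsSum n (V n ω) (fun i => X i ω) f g|} := by
  have part : ∀ (h : Obs p → ℝ) (W : ℕ → Ω → Finset ℕ), MemLp h 2 D → ∫ o, h o ∂D = 0 →
      (∀ n, Measurable (W n)) → (∀ n ω, W n ω ⊆ Finset.range n) →
      (∀ n, IndepFun (W n) (fun ω (i : Fin n) => X i ω) P) →
      NegligibleEvents P fun T n => {ω | T / 2 * √n ≤ |∑ i ∈ W n ω, h (X i ω)|} := by
    intro h W hh hh0 hW hWs hWi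
    -- The level T√n is shared by the two parts, each receiving T/2; squaring produces the 4.
    have hlim : Tendsto (fun T : ℝ => (4 * ∫ o, h o ^ 2 ∂D) / T ^ 2) atTop (𝓝 0) :=
      Tendsto.div_atTop tendsto_const_nhds (tendsto_pow_atTop two_ne_zero)
    refine NegligibleEvents.of_real_le hlim ?_
    filter_upwards [eventually_gt_atTop 0] with T hT
    filter_upwards [eventually_gt_atTop 0] with n hn
    have hnp : (0 : ℝ) < n := by exact_mod_cast hn
    refine (measureReal_randomSum_ge_le hdesign.law hdesign.indep hh hh0 (hW n) (hWs n) (hWi n)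
      (t := T / 2 * √n) (by positivity)).trans_eq ?_
    rw [mul_pow, Real.sq_sqrt hnp.le]
    field_simp
    ring
  refine ((part f V hf hf0 hdesign.measurable_sel hdesign.subset hdesign.indep_sel).union
    (part g (fun n ω => Finset.range n \ V n ω) hg hg0 hdesign.measurable_compl
      (fun n ω => Finset.sdiff_subset) hdesign.indep_compl)).mono ?_
  refine Eventually.of_forall fun T => Eventually.of_forall fun n ω hω => ?_
  by_contra hcon
  simp only [Set.mem_union, Set.mem_ofPred_eq, not_or, not_le, obsSum] at hcon hω
  have := abs_add_le (∑ i ∈ V n ω, f (X i ω)) (∑ i ∈ Finset.range n \ V n ω, g (X i ω))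
  linarith [hcon.1, hcon.2]

/-- Law of large numbers for sums over the two parts of the sample. -/
theorem negligible_obsSum_add [IsProbabilityMeasure P] [IsProbabilityMeasure D]
    (hdesign : ValidationDesign P D X nv V) {δ : ℝ}
    (hnv : Tendsto (fun n => (nv n : ℝ) / n) atTop (𝓝 δ)) {f g : Obs p → ℝ}
    (hf : Integrable f D) (hg : Integrable g D) {a b : ℝ} (hfa : ∫ o, f o ∂D = -a)
    (hgb : ∫ o, g o ∂D = -b) {η : ℝ} (hη : 0 < η) :
    NegligibleEvents P fun _ n => {ω | η * n <
      |obsSum n (V n ω) (fun i => X i ω) f g + n * (δ * a + (1 - δ) * b)|} := by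
  have part : ∀ (h : Obs p → ℝ) (c : ℝ) (W : ℕ → Ω → Finset ℕ), Integrable h D →
      ∫ o, h o ∂D = -c → (∀ n, Measurable (W n)) → (∀ n ω, W n ω ⊆ Finset.range n) →
      (∀ n, IndepFun (W n) (fun ω (i : Fin n) => X i ω) P) →
      NegligibleEvents P fun _ n => {ω | η / 3 * n ≤ |∑ i ∈ W n ω, (h (X i ω) + c)|} := by
    intro h c W hh hhc hW hWs hWi ε hε
    refine Eventually.of_forall fun _ => ?_
    have h0 : ∫ o, (h o + c) ∂D = 0 := by
      rw [integral_add hh (integrable_const c), hhc]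
      simp
    filter_upwards [eventually_measureReal_randomSum_ge_le hdesign.law hdesign.indep
      (hh.add (integrable_const c)) h0 hW hWs hWi (η := η / 3) (by positivity) hε] with n hn
    rw [← ofReal_measureReal (measure_ne_top _ _)]
    exact ENNReal.ofReal_le_ofReal hn
  have hlim : Tendsto (fun n => |(δ - (nv n : ℝ) / n) * (a - b)|) atTop (𝓝 0) := by
    simpa using ((hnv.const_sub δ).mul_const (a - b)).abs
  refine ((part f a V hf hfa hdesign.measurable_sel hdesign.subset hdesign.indep_sel).union
    (part g b (fun n ω => Finset.range n \ V n ω) hg hgb hdesign.measurable_compl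
      (fun n ω => Finset.sdiff_subset) hdesign.indep_compl)).mono ?_
  refine Eventually.of_forall fun T => ?_
  filter_upwards [hlim.eventually (gt_mem_nhds (show 0 < η / 3 by positivity)),
    eventually_gt_atTop 0] with n hn hn0 ω hω
  have hnp : (0 : ℝ) < n := by exact_mod_cast hn0
  by_contra hcon
  simp only [Set.mem_union, Set.mem_ofPred_eq, not_or, not_le, obsSum] at hcon hω
  have hcard : ((Finset.range n \ V n ω).card : ℝ) = n - nv n := by
    rw [Finset.card_sdiff_of_subset (hdesign.subset n ω), Finset.card_range, hdesign.card,
      Nat.cast_sub]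
    rw [← hdesign.card n ω]
    exact (Finset.card_le_card (hdesign.subset n ω)).trans_eq (Finset.card_range n)
  -- Besides the two centred sums there is a deterministic error from replacing n_v/n by its limit
  -- δ. Each of the three pieces is allowed ηn/3.
  have heq : ∑ i ∈ V n ω, f (X i ω) + ∑ i ∈ Finset.range n \ V n ω, g (X i ω)
        + n * (δ * a + (1 - δ) * b)
      = ∑ i ∈ V n ω, (f (X i ω) + a) + ∑ i ∈ Finset.range n \ V n ω, (g (X i ω) + b)
        + n * ((δ - (nv n : ℝ) / n) * (a - b)) := by
    rw [Finset.sum_add_distrib, Finset.sum_add_distrib, Finset.sum_const, Finset.sum_const,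
      nsmul_eq_mul, nsmul_eq_mul, hcard, hdesign.card]
    field_simp
    ring
  have h3 : |n * ((δ - (nv n : ℝ) / n) * (a - b))| < n * (η / 3) := by
    rw [abs_mul, abs_of_pos hnp]
    exact mul_lt_mul_of_pos_left hn hnp
  rw [heq] at hω
  have h1 := abs_add_le (∑ i ∈ V n ω, (f (X i ω) + a) +
    ∑ i ∈ Finset.range n \ V n ω, (g (X i ω) + b)) (n * ((δ - (nv n : ℝ) / n) * (a - b)))
  have h2 := abs_add_le (∑ i ∈ V n ω, (f (X i ω) + a))
    (∑ i ∈ Finset.range n \ V n ω, (g (X i ω) + b))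
  linarith [hcon.1, hcon.2]

/-- Sums of integrable terms over the sample are `O_p(n)`. -/
theorem negligible_sum_range [IsProbabilityMeasure P] (hdesign : ValidationDesign P D X nv V)
    {h : Obs p → ℝ} (hh : Integrable h D) :
    NegligibleEvents P fun T n => {ω | T * n < ∑ i ∈ Finset.range n, h (X i ω)} := by
  have hlim : Tendsto (fun T : ℝ => (∫ o, |h o| ∂D) / T) atTop (𝓝 0) :=
    Tendsto.div_atTop tendsto_const_nhds tendsto_id
  refine NegligibleEvents.of_real_le hlim ?_
  filter_upwards [eventually_gt_atTop 0] with T hT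
  filter_upwards [eventually_gt_atTop 0] with n hn
  have hnp : (0 : ℝ) < n := by exact_mod_cast hn
  have hM := mul_measureReal_sum_ge_le hdesign.law hh (n := n) (v := Finset.range n)
    subset_rfl (T * n)
  have hmono : P.real {ω | T * n < ∑ i ∈ Finset.range n, h (X i ω)}
      ≤ P.real {ω | T * n ≤ |∑ i ∈ Finset.range n, h (X i ω)|} := by
    refine measureReal_mono fun ω hω => ?_
    have hω' : T * n < ∑ i ∈ Finset.range n, h (X i ω) := hω
    exact hω'.le.trans (le_abs_self _)
  rw [le_div_iff₀ hT]
  refine le_of_mul_le_mul_left (le_trans ?_ hM) hnp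
  calc n * (P.real {ω | T * n < ∑ i ∈ Finset.range n, h (X i ω)} * T)
      ≤ n * (P.real {ω | T * n ≤ |∑ i ∈ Finset.range n, h (X i ω)|} * T) := by gcongr
    _ = _ := by ring

theorem measurable_sum_sel (hdesign : ValidationDesign P D X nv V) {h : Obs p → ℝ}
    (hh : Measurable h) {n : ℕ} {W : Ω → Finset ℕ} (hW : Measurable W)
    (hWs : ∀ ω, W ω ⊆ Finset.range n) : Measurable fun ω => ∑ i ∈ W ω, h (X i ω) := by
  have : (fun ω => ∑ i ∈ W ω, h (X i ω))
      = fun ω => ∑ i ∈ Finset.range n, if i ∈ W ω then h (X i ω) else 0 := by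
    ext ω
    rw [← Finset.sum_filter, Finset.filter_mem_eq_inter, Finset.inter_eq_right.2 (hWs ω)]
  rw [this]
  refine Finset.measurable_fun_sum _ fun i _ => Measurable.ite ?_
    (hh.comp (hdesign.measurable_obs i)) measurable_const
  exact hW (MeasurableSet.of_discrete (s := {v : Finset ℕ | i ∈ v}))

end ValidationDesign

end Design

/-! ### Good samples are likely, and the theorem follows. -/

section Main

variable {p q : ℕ} {M : MisclassModel p q} {θ₀ : Param p q} {Ω : Type*} [MeasurableSpace Ω]
  {P : Measure Ω} {D : Measure (Obs p)} {X : ℕ → Ω → Obs p} {nv : ℕ → ℕ}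
  {V : ℕ → Ω → Finset ℕ} {δ : ℝ} {N : Set (Param p q)}

theorem RegularityConditions.exists_smoothObs (hreg : RegularityConditions M D δ θ₀ N) :
    ∃ BV BM : Obs p → ℝ, Integrable BV D ∧ Integrable BM D ∧
      ∀ᵐ o ∂D, SmoothObs M N BV BM o := by
  obtain ⟨BV, hBV, h1⟩ := hreg.smoothV.third
  obtain ⟨BM, hBM, h2⟩ := hreg.smoothM.third
  refine ⟨BV, BM, hBV, hBM, ?_⟩
  filter_upwards [h1, h2, hreg.smoothV.contDiffOn, hreg.smoothM.contDiffOn] with o a b c d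
  exact ⟨c o.1 o.2.1, d o.1 o.2.1, a, b⟩

/-- Smoothness fails only on a null event. The Bartlett identities centre the score for Chebyshev
and identify the Hessian limit for the law of large numbers, while Markov controls the third
derivatives. Only the score and third derivative bounds need T large; η stays fixed. -/
theorem negligible_not_goodSample [IsProbabilityMeasure P] [IsProbabilityMeasure D]
    (hD : M.Follows θ₀ D) (hdesign : ValidationDesign P D X nv V)
    (hnv : Tendsto (fun n => (nv n : ℝ) / n) atTop (𝓝 δ))
    (hreg : RegularityConditions M D δ θ₀ N) {BV BM : Obs p → ℝ} (hBV : Integrable BV D)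
    (hBM : Integrable BM D) (hs : ∀ᵐ o ∂D, SmoothObs M N BV BM o) {η : ℝ} (hη : 0 < η) :
    NegligibleEvents P fun T n => {ω | ¬ GoodSample M N BV BM θ₀ (limitInfo M D δ θ₀) η T n
      (V n ω) (fun i => X i ω)} := by
  have hV := bartlettIdentities_logV hD hreg
  have hM := bartlettIdentities_logM hD hreg
  have e1 : NegligibleEvents P fun _ _ => {ω | ¬ ∀ i, SmoothObs M N BV BM (X i ω)} :=
    NegligibleEvents.of_measure_eq_zero fun _ _ => ae_forall_eq_comp hdesign.law hs
  have e2 := NegligibleEvents.iUnion fun j => hdesign.negligible_obsSum_sqrt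
    (hreg.smoothV.score j) (hreg.smoothM.score j) (hV.score j) (hM.score j)
  have e3 := NegligibleEvents.iUnion fun j => NegligibleEvents.iUnion fun k =>
    hdesign.negligible_obsSum_add hnv (hreg.smoothV.hessian j k) (hreg.smoothM.hessian j k)
      (hV.hessian j k) (hM.hessian j k) hη
  have e4 := hdesign.negligible_sum_range (hBV.abs.add hBM.abs)
  refine (((e1.union e2).union e3).union e4).mono ?_
  refine Eventually.of_forall fun T => Eventually.of_forall fun n ω hω => ?_
  by_contra hcon
  simp only [Set.mem_union, not_or, Set.mem_iUnion, not_exists, Set.mem_ofPred_eq, not_lt,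
    not_not] at hcon
  obtain ⟨⟨⟨h1, h2⟩, h3⟩, h4⟩ := hcon
  exact hω ⟨h1, h2, fun j k => by simpa [limitInfo, hessSum] using h3 j k, by simpa using h4⟩

theorem measurable_penLogLik (hdesign : ValidationDesign P D X nv V) (ρ : ℝ → ℝ → ℝ) (l : ℝ)
    (n : ℕ) (θ : Param p q) :
    Measurable fun ω => penLogLik M ρ l n (V n ω) (fun i => X i ω) θ := by
  refine Measurable.sub_const (Measurable.add ?_ ?_) _
  · exact hdesign.measurable_sum_sel (M.measurable_logV θ) (hdesign.measurable_sel n)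
      (hdesign.subset n)
  · exact hdesign.measurable_sum_sel (M.measurable_logM θ) (hdesign.measurable_compl n)
      fun ω => Finset.sdiff_subset

theorem continuousOn_penLogLik {BV BM : Obs p → ℝ} {ρ : ℝ → ℝ → ℝ} (hρ : IsPenalty ρ) {l : ℝ}
    (hl : 0 ≤ l) (n : ℕ) (v : Finset ℕ) {x : ℕ → Obs p}
    (hx : ∀ i, SmoothObs M N BV BM (x i)) : ContinuousOn (penLogLik M ρ l n v x) N := by
  refine ContinuousOn.sub (ContinuousOn.add ?_ ?_) (Continuous.continuousOn ?_)
  · exact continuousOn_finsetSum _ fun i _ => (hx i).contV.continuousOn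
  · exact continuousOn_finsetSum _ fun i _ => (hx i).contM.continuousOn
  · refine continuous_const.mul (continuous_finsetSum _ fun j _ => ?_)
    refine (hρ.continuousOn l hl).comp_continuous ?_ fun θ => Set.mem_Ici.2 (abs_nonneg _)
    unfold Param.beta
    fun_prop

end Main

theorem mainTheorem1 {p q : ℕ} (M : MisclassModel p q) (θ₀ : Param p q)
    {Ω : Type*} [MeasurableSpace Ω] (P : Measure Ω) [IsProbabilityMeasure P]
    (D : Measure (Obs p)) [IsProbabilityMeasure D] (hD : M.Follows θ₀ D)
    (X : ℕ → Ω → Obs p) (nv : ℕ → ℕ) (V : ℕ → Ω → Finset ℕ)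
    (hdesign : ValidationDesign P D X nv V)
    (δ : ℝ) (hδ : 0 < δ ∧ δ ≤ 1)
    (hnv : Tendsto (fun n => (nv n : ℝ) / n) atTop (𝓝 δ))
    (N : Set (Param p q)) (hreg : RegularityConditions M D δ θ₀ N)
    (ρ : ℝ → ℝ → ℝ) (hρ : IsPenalty ρ) (lam : ℕ → ℝ) (hlam_nonneg : ∀ n, 0 ≤ lam n)
    (hsmooth : PenaltySmooth ρ lam)
    (hlam : Tendsto lam atTop (𝓝 0))
    (ha : Tendsto (aSeq ρ lam θ₀) atTop (𝓝 0))
    (hb : Tendsto (bSeq ρ lam θ₀) atTop (𝓝 0)) :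
    ∃ est : ℕ → Ω → Param p q,
      (∀ n, Measurable (est n)) ∧
      Tendsto (fun n => P {ω | ¬ IsLocalMax
        (penLogLik M ρ (lam n) n (V n ω) (fun i => X i ω)) (est n ω)}) atTop (𝓝 0) ∧
      IsBigOInProb P (fun n ω => ‖est n ω - θ₀‖)
        (fun n => (n : ℝ) ^ (-(1 / 2) : ℝ) + aSeq ρ lam θ₀ n) := by
  obtain ⟨BV, BM, hBV, hBM, hs⟩ := hreg.exists_smoothObs
  obtain ⟨r₀, hr₀, hball⟩ := Metric.nhds_basis_closedBall.mem_iff.1 (hreg.isOpen.mem_nhds hreg.mem)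
  obtain ⟨c, hc, hA⟩ := Matrix.PosDef.exists_mul_norm_sq_le hreg.posDef
  set d := (Fintype.card (Unit ⊕ Fin p ⊕ Fin q) : ℝ) with hd
  have hdp : 0 < d := by
    rw [hd]
    exact_mod_cast Fintype.card_pos
  have hα : Tendsto (fun n : ℕ => (n : ℝ) ^ (-(1 / 2) : ℝ) + aSeq ρ lam θ₀ n) atTop (𝓝 0) := by
    have := (tendsto_rpow_neg_atTop (y := 1 / 2) (by norm_num)).comp
      (tendsto_natCast_atTop_atTop (R := ℝ))
    simpa using this.add ha
  have hpow : ∀ n : ℕ, (0 : ℝ) ≤ (n : ℝ) ^ (-(1 / 2) : ℝ) := fun n =>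
    Real.rpow_nonneg (Nat.cast_nonneg n) _
  refine exists_measurable_isLocalMax hr₀
    (fun n θ _ => measurable_penLogLik hdesign ρ (lam n) n θ) ?_
    (fun n => add_nonneg (hpow n) (aSeq_nonneg ρ lam θ₀ n)) hα ?_
  · filter_upwards [ae_forall_eq_comp hdesign.law hs] with ω hω n
    exact (continuousOn_penLogLik hρ (hlam_nonneg n) n _ hω).mono hball
  · intro ε hε
    -- Constants are fixed in the order η, T, K: η makes d²η = c/2, T makes bad samples rarer than
    -- ε, and K then lets the curvature beat dT + p. K is a natural number because the radii of the
    -- estimator are so indexed.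
    have hη : 0 < c / 2 / d ^ 2 := by positivity
    obtain ⟨T, hTε, hT⟩ := ((negligible_not_goodSample hD hdesign hnv hreg hBV hBM hs hη ε hε).and
      (eventually_ge_atTop 0)).exists
    obtain ⟨K, hK⟩ := exists_nat_gt ((d * T + p) / (c / 8))
    have hK0 : (0 : ℝ) < K := lt_of_le_of_lt (by positivity) hK
    refine ⟨K, ?_⟩
    have hmain := eventually_penLogLik_lt (M := M) (BV := BV) (BM := BM) hreg.isOpen hreg.mem hρ
      hlam_nonneg hsmooth hlam hb hc hA (η := c / 2 / d ^ 2) (T := T) (K := K)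
      (by rw [← hd, mul_div_cancel₀ _ (by positivity)]) hT hK0
      (by rw [div_lt_iff₀ (by positivity)] at hK; linarith) hα
      (fun n hn => by
        have hnp : (0 : ℝ) < n := by exact_mod_cast hn
        -- Since n · n^{-1/2} = √n, the n^{-1/2} part of the rate absorbs the score.
        have h1 : (n : ℝ) * (n : ℝ) ^ (-(1 / 2) : ℝ) = √n := by
          rw [Real.sqrt_eq_rpow, ← Real.rpow_one_add' hnp.le (by norm_num)]
          norm_num
        rw [mul_add, h1]
        have := mul_nonneg hnp.le (aSeq_nonneg ρ lam θ₀ n)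
        linarith)
      (fun n => by linarith [hpow n])
    filter_upwards [hTε, hmain] with n h1 h2
    refine (measure_mono fun ω hω => ?_).trans h1
    exact fun hgood => hω (h2 (V n ω) (hdesign.subset n ω) _ hgood)
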